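/- **Notation.** Let $k\ge 1$. All $k$-tuples below have integer entries. For $n\ge k$ let $\mathcal I_{n,k}$ be the set of tuples $v$ with $1\le v_1<\dots<v_k\le n$. For a tuple $v$, let $v^{\uparrow}$ be $v$ sorted in non-decreasing order and $\mathfrak P(v)$ the set of its distinct permutations. For a weakly decreasing tuple $\lambda$ of nonnegative integers let $\mathcal D_\lambda$ be the set of weakly decreasing tuples $\mu$ of nonnegative integers with $\sum_i\mu_i=\sum_i\lambda_i$. For $g\in\mathbb C^{\mathbb Z}$, $H^g(t,m,n)\in\mathbb C^{m\times n}$ is the Hankel matrix with $(i,j)$ entry $g_{t+i+j-2}$. For a matrix $X$ and increasing tuples $s,r$ of row and column indices, $|X_{(s,r)}|$ is the minor with rows $s$ and columns $r$. A complex matrix is *$k$-sign consistent* if all its $k$-minors are real and nonnegative or all are real and nonpositive, and *strictly $k$-sign consistent* if all its $k$-minors are real and positive or all are real and negative. For weakly decreasing tuples $\lambda,\varepsilon,\gamma$ of nonnegative integers, the Littlewood–Richardson coefficient $c^{\gamma}_{\lambda,\varepsilon}$ is the number of fillings of the skew Young diagram $\gamma/\lambda$ with entries in $\{1,\dots,k\}$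 in which each integer $i$ occurs exactly $\varepsilon_i$ times, entries weakly increase along rows (left to right) and strictly increase along columns (top to bottom), and the word obtained by reading the rows from right to left, top to bottom, is a lattice word: every prefix contains $i$ at least as often as $i+1$, for all $1\le i<k$. It is $0$ unless $\lambda_i\le\gamma_i$ for all $i$. **Theorem.** Let $g\in\mathbb C^{\mathbb Z}$, $1\le k\le\min\{M,N\}$ and $A:=H^g(1,M,N)$. For $i\in\mathbb Z^k$ put $$b^g_{(i_1,\dots,i_k)}:=\begin{vmatrix} g_{i_1}&\dots&g_{i_k}\\ \vdots&&\vdots\\ g_{i_1+k-1}&\dots&g_{i_k+k-1}\end{vmatrix}.$$ Let $s\in\mathcal I_{M,k}$ and $r\in\mathcal I_{N,k}$. For $i=1,\dots,k$ put $\lambda_i:=s_{k-i+1}-(k-i+1)$, $\varepsilon_i:=r_{k-i+1}-k+i$ and $\gamma_i(v^*):=v^*_{k-i+1}-k+i$, and let $$V^*:=\{(p+r)^{\uparrow}:\ p\in\mathfrak P(\mu),\ \mu\in\mathcal D_\lambda,\ (p+r)^{\uparrow}\text{ is strictly increasing}\}.$$ Then $$|A_{(s,r)}|=\sum_{v^*\in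 V^*}c^{\gamma(v^*)}_{\lambda,\varepsilon}\,b^g_{v^*},$$ and for every $v^*\in V^*$ with $c^{\gamma(v^*)}_{\lambda,\varepsilon}\ne0$ one has $v^*\in\mathcal I_{M+N-k,k}$, so that $b^g_{v^*}$ is the $k$-minor of the reshaped Hankel matrix $H^g(1,k,M+N-k)$ with columns $v^*$. In particular, if $H^g(1,k,M+N-k)$ is $k$-sign consistent, then $A$ is $k$-sign consistent; and if $H^g(1,k,M+N-k)$ is strictly $k$-sign consistent, then $A$ is strictly $k$-sign consistent. -/

import Mathlib

namespace HankelMinor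

/-- The Hankel matrix with `m` rows, `n` columns and upper left entry `g t`; in one-based
indices its `(i, j)` entry is `g (t + i + j - 2)`. -/
def hankel (g : ℤ → ℂ) (t : ℤ) (m n : ℕ) : Matrix (Fin m) (Fin n) ℂ :=
  Matrix.of fun i j => g (t + (i : ℤ) + (j : ℤ))

/-- The `k`-minor of `X` with rows `p 0 < p 1 < ⋯` and columns `q 0 < q 1 < ⋯`. -/
def minor {m n k : ℕ} (X : Matrix (Fin m) (Fin n) ℂ) (p : Fin k ↪o Fin m) (q : Fin k ↪o Fin n) :
    ℂ :=
  (X.submatrix p q).det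

open scoped ComplexOrder in
/-- All `k`-minors are real and nonnegative, or all `k`-minors are real and nonpositive
(in Mathlib's order on `ℂ`, `0 ≤ z` means that `z` is a nonnegative real number). -/
def SignConsistent (k : ℕ) {m n : ℕ} (X : Matrix (Fin m) (Fin n) ℂ) : Prop :=
  (∀ (p : Fin k ↪o Fin m) (q : Fin k ↪o Fin n), 0 ≤ minor X p q) ∨
    (∀ (p : Fin k ↪o Fin m) (q : Fin k ↪o Fin n), minor X p q ≤ 0)

open scoped ComplexOrder in
/-- All `k`-minors are real and positive, or all `k`-minors are real and negative. -/
def StrictSignConsistent (k : ℕ) {m n : ℕ} (X : Matrix (Fin m) (Fin n) ℂ) : Prop :=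
  (∀ (p : Fin k ↪o Fin m) (q : Fin k ↪o Fin n), 0 < minor X p q) ∨
    (∀ (p : Fin k ↪o Fin m) (q : Fin k ↪o Fin n), minor X p q < 0)

/-- An increasing tuple in `Fin n` as an increasing tuple of integers in `{1, …, n}`. -/
def oneBased {n k : ℕ} (p : Fin k ↪o Fin n) : Fin k → ℤ :=
  fun i => (p i : ℤ) + 1

/-- The determinant whose `j`-th column is `(g (i j), g (i j + 1), …, g (i j + k - 1))`. -/
def bMinor (g : ℤ → ℂ) {k : ℕ} (i : Fin k → ℤ) : ℂ :=
  (Matrix.of fun a j : Fin k => g (i j + (a : ℤ))).det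

/-- The weakly decreasing tuples of nonnegative integers with the same sum as `lam`. -/
def partitionsOf {k : ℕ} (lam : Fin k → ℤ) : Set (Fin k → ℤ) :=
  {v | (∀ i, 0 ≤ v i) ∧ Antitone v ∧ ∑ i, v i = ∑ i, lam i}

/-- The set of all distinct permutations of the tuple `v`. -/
def permutations {k : ℕ} (v : Fin k → ℤ) : Set (Fin k → ℤ) :=
  {p | ∃ σ : Equiv.Perm (Fin k), p = v ∘ σ}

/-- The tuple `v` sorted in non-decreasing order. -/
noncomputable def sortUp {k : ℕ} (v : Fin k → ℤ) : Fin k → ℤ :=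
  v ∘ Tuple.sort v

/-- The strictly increasing tuples among the `sortUp (p + r)`, where `p` runs through the
permutations of all `mu ∈ partitionsOf lam`. -/
def vStarSet {k : ℕ} (lam r : Fin k → ℤ) : Set (Fin k → ℤ) :=
  {v | StrictMono v ∧ ∃ mu ∈ partitionsOf lam, ∃ p ∈ permutations mu, v = sortUp (p + r)}

theorem vStarSet_finite {k : ℕ} (lam r : Fin k → ℤ) : (vStarSet lam r).Finite := by
  refine ((Set.finite_Icc (0 : Fin k → ℤ) (fun _ => ∑ i, lam i)).image
    (fun p => sortUp (p + r))).subset ?_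
  rintro v ⟨-, mu, ⟨h0, -, hs⟩, p, ⟨σ, rfl⟩, rfl⟩
  refine ⟨mu ∘ σ, ⟨fun i => h0 _, fun i => ?_⟩, rfl⟩
  rw [← hs]
  exact Finset.single_le_sum (f := mu) (fun j _ => h0 j) (Finset.mem_univ (σ i))

/-- `vStarSet lam r` as a finite set. -/
noncomputable def vStar {k : ℕ} (lam r : Fin k → ℤ) : Finset (Fin k → ℤ) :=
  (vStarSet_finite lam r).toFinset

/-- The boxes `(i, j)` (row `i`, column `j`) of the skew Young diagram of shape `gam / lam`. -/
noncomputable def skewCells {k : ℕ} (gam lam : Fin k → ℤ) : Finset (Fin k × ℤ) :=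
  Finset.univ.biUnion fun i => (Finset.Ioc (lam i) (gam i)).image fun j => (i, j)

/-- The box `d` is read no later than the box `c` when a tableau is read row by row from
top to bottom, each row from right to left. -/
def ReadNoLater {k : ℕ} (d c : Fin k × ℤ) : Prop :=
  d.1 < c.1 ∨ (d.1 = c.1 ∧ c.2 ≤ d.2)

open Classical in
/-- `T` is a Littlewood–Richardson tableau of shape `gam / lam` and weight `mu`; the entry
`a : Fin k` stands for the integer `a + 1`. -/
structure IsLRTableau {k : ℕ} (lam mu gam : Fin k → ℤ) (T : skewCells gam lam → Fin k) :
    Prop where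
  row_weak : ∀ c d : skewCells gam lam, c.1.1 = d.1.1 → c.1.2 < d.1.2 → T c ≤ T d
  col_strict : ∀ c d : skewCells gam lam, c.1.2 = d.1.2 → c.1.1 < d.1.1 → T c < T d
  weight : ∀ a : Fin k, ((Finset.univ.filter fun c => T c = a).card : ℤ) = mu a
  lattice : ∀ (c : skewCells gam lam) (a b : Fin k), (b : ℕ) = (a : ℕ) + 1 →
    (Finset.univ.filter fun d => ReadNoLater d.1 c.1 ∧ T d = b).card ≤
      (Finset.univ.filter fun d => ReadNoLater d.1 c.1 ∧ T d = a).card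

/-- The Littlewood–Richardson coefficient `c^gam_{lam, mu}`, which is zero unless
`lam ≤ gam` entrywise. -/
noncomputable def lrCoeff {k : ℕ} (lam mu gam : Fin k → ℤ) : ℕ :=
  Nat.card {T : skewCells gam lam → Fin k // lam ≤ gam ∧ IsLRTableau lam mu gam T}

/-- In one-based indices, `lam i = s (k - i + 1) - (k - i + 1)`. -/
def lamOf {k : ℕ} (s : Fin k → ℤ) : Fin k → ℤ :=
  fun i => s i.rev - ((i.rev : ℤ) + 1)

/-- In one-based indices, the `i`-th entry is `v (k - i + 1) - k + i`. -/
def shapeOf {k : ℕ} (v : Fin k → ℤ) : Fin k → ℤ :=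
  fun i => v i.rev - (k : ℤ) + ((i : ℤ) + 1)

end HankelMinor

/-! The linear functional z^p ↦ ∏ g(p_i) on polynomials sends z^s times the alternant with exponents
r + 1 to the minor of the Hankel matrix, and z^w times the Vandermonde determinant to b^g_w. By
Jacobi–Trudi (`alternant_eq_det_complete_mul`) the alternant is the Vandermonde determinant times a
determinant of complete homogeneous polynomials. Expanding the latter writes the minor as a signed
sum of values of b^g (`minor_hankel_eq_sum`). Its terms are chains of integer rows that start at s,
where step j adds an exponent vector whose degree is prescribed by a permutation π. As b^g
alternates in its index, it behaves like an alternant, and the claim becomes the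
Littlewood–Richardson rule for multiplying by a Schur function.

Two sign-reversing involutions clear the sum (`sum_signed_chains`). If consecutive rows fail to
interlace, two entries are exchanged on all later levels; this keeps π and changes the sign of b^g.
If the chain interlaces but its reading word is not a lattice word, one level is reflected in
Bender–Knuth fashion; this keeps the last row and multiplies π by an adjacent transposition. In the
surviving chains π = 1, and they are the chains of shapes of Littlewood–Richardson tableaux
(`lrCoeff_eq_card`).

Grouping the survivors by last row gives the expansion. In a lattice chain letter j occurs only in
rows from j on, which places the last row in V* (`IsLRChain.last_mem_vStar`) and inside {1, …,
M+N-k} (`IsLRChain.exists_eq_oneBased`). All coefficients are nonnegative integers, which gives sign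
consistency. The tableau with all letters j in row j shows that some coefficient is nonzero, which
gives strictness. -/

namespace HankelMinor

/-! ### Complete homogeneous polynomials and the Jacobi–Trudi identity. -/

open Finset in
/-- The tuples of natural numbers with sum `n`. -/
def comps (k : ℕ) (n : ℤ) : Finset (Fin k → ℕ) :=
  if 0 ≤ n then piAntidiag univ n.toNat else ∅

theorem mem_comps {k : ℕ} {n : ℤ} {p : Fin k → ℕ} : p ∈ comps k n ↔ ∑ i, (p i : ℤ) = n := by
  unfold comps
  split_ifs with h
  · rw [Finset.mem_piAntidiag]
    have : ∑ i, (p i : ℤ) = ((Finset.univ.sum p : ℕ) : ℤ) := by push_cast; rfl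
    rw [this]
    constructor
    · rintro ⟨h1, -⟩
      omega
    · intro h1
      exact ⟨by omega, by simp⟩
  · simp only [Finset.notMem_empty, false_iff]
    intro h1
    exact h (h1 ▸ Finset.sum_nonneg fun i _ => by positivity)

/-- The complete homogeneous symmetric polynomial of degree `n` evaluated at `x`, zero if `n` is
negative. -/
def complete {R : Type*} [CommRing R] {k : ℕ} (x : Fin k → R) (n : ℤ) : R :=
  ∑ p ∈ comps k n, ∏ i, x i ^ p i

section Complete

variable {R : Type*} [CommRing R] {k : ℕ}

theorem complete_of_neg (x : Fin k → R) {n : ℤ} (hn : n < 0) : complete x n = 0 := by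
  simp [complete, comps, not_le.2 hn]

theorem complete_zero (x : Fin k → R) : complete x 0 = 1 := by
  simp [complete, comps]

open PowerSeries in
theorem coeff_prod_geometric (x : Fin k → R) (n : ℕ) :
    coeff n (∏ l, PowerSeries.mk fun m => x l ^ m) = complete x n := by
  rw [PowerSeries.coeff_prod]
  simp only [PowerSeries.coeff_mk]
  refine Finset.sum_bij (fun p _ => (p : Fin k → ℕ)) ?_ ?_ ?_ ?_
  · intro p hp
    rw [Finset.mem_finsuppAntidiag] at hp
    rw [mem_comps, ← hp.1]
    push_cast
    rfl
  · intro p _ q _ h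
    exact DFunLike.coe_injective h
  · intro p hp
    rw [mem_comps] at hp
    refine ⟨Finsupp.equivFunOnFinite.symm p, ?_, rfl⟩
    rw [Finset.mem_finsuppAntidiag]
    refine ⟨?_, by simp⟩
    zify
    exact hp
  · intro p _
    rfl

open PowerSeries in
theorem geometric_mul_one_sub (y : R) :
    (PowerSeries.mk fun m => y ^ m) * (1 - C y * X) = 1 := by
  ext n
  rw [mul_sub, mul_one, ← mul_assoc, map_sub]
  cases n with
  | zero => simp
  | succ n =>
    rw [coeff_succ_mul_X, mul_comm _ (C y), coeff_C_mul, coeff_mk, coeff_mk, coeff_one]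
    simp [pow_succ, mul_comm]

/-- The polynomial `∏ (1 - x m t)` over all `m ≠ l`. -/
noncomputable def cofactorPoly (x : Fin k → R) (l : Fin k) : Polynomial R :=
  ∏ m ∈ Finset.univ.erase l, (1 - Polynomial.C (x m) * Polynomial.X)

theorem coeff_cofactorPoly_of_le (x : Fin k → R) (l : Fin k) {j : ℕ} (hj : k ≤ j) :
    (cofactorPoly x l).coeff j = 0 := by
  apply Polynomial.coeff_eq_zero_of_natDegree_lt
  have h1 : (cofactorPoly x l).natDegree ≤ ∑ m ∈ Finset.univ.erase l, 1 := by
    refine (Polynomial.natDegree_prod_le _ _).trans (Finset.sum_le_sum fun m _ => ?_)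
    refine (Polynomial.natDegree_sub_le _ _).trans ?_
    simp only [Polynomial.natDegree_one, zero_le, sup_of_le_right]
    exact (Polynomial.natDegree_C_mul_le _ _).trans Polynomial.natDegree_X_le
  have h2 := l.pos
  simp only [Finset.sum_const, Finset.card_erase_of_mem (Finset.mem_univ l), Finset.card_univ,
    Fintype.card_fin, smul_eq_mul, mul_one] at h1
  omega

open PowerSeries in
theorem prod_geometric_mul_cofactorPoly (x : Fin k → R) (l : Fin k) :
    (∏ m, PowerSeries.mk fun n => x m ^ n) * (cofactorPoly x l : PowerSeries R) =
      PowerSeries.mk fun n => x l ^ n := by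
  have h : (cofactorPoly x l : PowerSeries R) =
      ∏ m ∈ Finset.univ.erase l, (1 - C (x m) * X) := by
    rw [cofactorPoly, ← Polynomial.coeToPowerSeries.ringHom_apply, map_prod]
    simp
  rw [h, ← Finset.mul_prod_erase _ _ (Finset.mem_univ l), mul_assoc, ← Finset.prod_mul_distrib,
    Finset.prod_eq_one fun m _ => geometric_mul_one_sub (x m), mul_one]

/-- Compare coefficients in 1/(1 - x_l t) = ∏ 1/(1 - x_m t) · ∏_{m ≠ l} (1 - x_m t). The last factor
does not depend on `n` and has degree below `k`, so matrices of powers factor with a right factor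
independent of the exponents. -/
theorem pow_eq_sum_complete (x : Fin k → R) (l : Fin k) (n : ℕ) :
    x l ^ n = ∑ j : Fin k, complete x ((n : ℤ) - (j : ℕ)) * (cofactorPoly x l).coeff j := by
  have h := congrArg (PowerSeries.coeff n) (prod_geometric_mul_cofactorPoly x l)
  rw [PowerSeries.coeff_mk, mul_comm, PowerSeries.coeff_mul,
    Finset.Nat.sum_antidiagonal_eq_sum_range_succ_mk] at h
  rw [← h, Fin.sum_univ_eq_sum_range
    (fun j => complete x ((n : ℤ) - (j : ℕ)) * (cofactorPoly x l).coeff j) k]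
  have e1 : ∀ j ∈ Finset.range (max k (n + 1)), j ∉ Finset.range k →
      complete x ((n : ℤ) - (j : ℕ)) * (cofactorPoly x l).coeff j = 0 := by
    intro j _ hj
    rw [coeff_cofactorPoly_of_le x l (by simpa using hj), mul_zero]
  have e2 : ∀ j ∈ Finset.range (max k (n + 1)), j ∉ Finset.range (n + 1) →
      complete x ((n : ℤ) - (j : ℕ)) * (cofactorPoly x l).coeff j = 0 := by
    intro j _ hj
    rw [Finset.mem_range] at hj
    rw [complete_of_neg x (by omega), zero_mul]
  rw [Finset.sum_subset (by simp) e1, ← Finset.sum_subset (by simp) e2]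
  refine Finset.sum_congr rfl fun j hj => ?_
  rw [Finset.mem_range] at hj
  rw [coeff_prod_geometric, Polynomial.coeff_coe, mul_comm, Nat.cast_sub (by omega)]

/-- The Jacobi–Trudi identity in the form "alternant = determinant of complete symmetric
polynomials times Vandermonde determinant". -/
theorem alternant_eq_det_complete_mul (x : Fin k → R) (a : Fin k → ℕ) :
    (Matrix.of fun i l : Fin k => x l ^ a i).det =
      (Matrix.of fun i j : Fin k => complete x ((a i : ℤ) - (j : ℕ))).det *
        (Matrix.of fun i l : Fin k => x l ^ (i : ℕ)).det := by
  have key : ∀ b : Fin k → ℕ, (Matrix.of fun i l : Fin k => x l ^ b i) =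
      (Matrix.of fun i j : Fin k => complete x ((b i : ℤ) - (j : ℕ))) *
        (Matrix.of fun j l : Fin k => (cofactorPoly x l).coeff j) := by
    intro b
    ext i l
    rw [Matrix.mul_apply]
    exact pow_eq_sum_complete x l (b i)
  -- For the exponents 0, …, k-1 the left factor is unitriangular, so the right factor has the
  -- Vandermonde determinant. No division is needed.
  have unit : (Matrix.of fun i j : Fin k =>
      complete x ((((i : ℕ) : ℕ) : ℤ) - (j : ℕ))).det = 1 := by
    rw [Matrix.det_of_isLowerTriangular]
    · simp [complete_zero]
    · intro i j hij
      have : (i : ℕ) < j := hij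
      exact complete_of_neg x (by omega)
  rw [key a, key fun i => (i : ℕ), Matrix.det_mul, Matrix.det_mul, unit, one_mul]

end Complete

/-! ### Umbral evaluation and the signed expansion of a Hankel minor. -/

/-- The linear functional sending the monomial `z ^ p` to `∏ i, g (p i)`. -/
noncomputable def evalFunctional (g : ℤ → ℂ) (k : ℕ) : MvPolynomial (Fin k) ℂ →ₗ[ℂ] ℂ :=
  (MvPolynomial.basisMonomials (Fin k) ℂ).constr ℂ fun p => ∏ i, g (p i)

theorem evalFunctional_prod (g : ℤ → ℂ) {k : ℕ} (p : Fin k → ℕ) :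
    evalFunctional g k (∏ i, MvPolynomial.X i ^ p i) = ∏ i, g (p i) := by
  have h : (∏ i, MvPolynomial.X i ^ p i : MvPolynomial (Fin k) ℂ) =
      MvPolynomial.basisMonomials (Fin k) ℂ (Finsupp.equivFunOnFinite.symm p) := by
    rw [MvPolynomial.coe_basisMonomials]
    beta_reduce
    rw [MvPolynomial.monomial_eq, Finsupp.prod_fintype _ _ (by simp)]
    simp
  rw [h, evalFunctional, Module.Basis.constr_basis]
  rfl

/-- In each Leibniz term the power of the `l`-th variable only shifts the `l`-th index. This serves
both for the alternant of the minor and for the Vandermonde determinant behind `bMinor`. -/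
theorem evalFunctional_mul_alternant (g : ℤ → ℂ) {k : ℕ} (p a : Fin k → ℕ) :
    evalFunctional g k ((∏ i, MvPolynomial.X i ^ p i) *
        (Matrix.of fun i l : Fin k => MvPolynomial.X l ^ a i).det) =
      (Matrix.of fun i l : Fin k => g ((p l : ℤ) + a i)).det := by
  rw [Matrix.det_apply', Matrix.det_apply', Finset.mul_sum, map_sum]
  refine Finset.sum_congr rfl fun σ _ => ?_
  have h : (∏ i, MvPolynomial.X i ^ p i : MvPolynomial (Fin k) ℂ) *
      (((Equiv.Perm.sign σ : ℤ) : MvPolynomial (Fin k) ℂ) *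
        ∏ i, (Matrix.of fun i l : Fin k => (MvPolynomial.X l ^ a i : MvPolynomial (Fin k) ℂ))
          (σ i) i) =
      ((Equiv.Perm.sign σ : ℤ) : ℂ) • ∏ i, MvPolynomial.X i ^ (p i + a (σ i)) := by
    rw [MvPolynomial.smul_eq_C_mul, mul_left_comm, ← Finset.prod_mul_distrib]
    simp [pow_add]
  rw [h, map_smul, evalFunctional_prod, smul_eq_mul]
  simp

theorem minor_hankel_eq_sum (g : ℤ → ℂ) {M N k : ℕ} (s : Fin k ↪o Fin M) (r : Fin k ↪o Fin N) :
    minor (hankel g 1 M N) s r =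
      ∑ π : Equiv.Perm (Fin k), ((Equiv.Perm.sign π : ℤ) : ℂ) *
        ∑ a ∈ Fintype.piFinset fun j : Fin k =>
            comps k (((r (π j).rev : ℕ) : ℤ) + 1 - ((j.rev : ℕ) : ℤ)),
          bMinor g fun i => ((s i : ℕ) : ℤ) + ∑ j, (a j i : ℤ) := by
  -- The offset 1 of the Hankel matrix is charged to the columns: `s` stays zero-based, while the
  -- resulting indices of `bMinor` are one-based.
  have h1 : minor (hankel g 1 M N) s r =
      (Matrix.of fun i l : Fin k => g (((s l : ℕ) : ℤ) + ((r i : ℕ) + 1 : ℕ))).det := by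
    rw [minor, ← Matrix.det_transpose]
    congr 1
    ext i l
    simp only [hankel, Matrix.transpose_apply, Matrix.submatrix_apply, Matrix.of_apply]
    congr 1
    push_cast
    ring
  -- Reversing rows and columns together makes the column data decreasing, as a partition plus
  -- staircase.
  rw [h1, ← evalFunctional_mul_alternant g (fun l => (s l : ℕ)) fun i => (r i : ℕ) + 1,
    alternant_eq_det_complete_mul, ← Matrix.det_submatrix_equiv_self Fin.revPerm,
    Matrix.det_apply', Finset.sum_mul, Finset.mul_sum, map_sum]
  refine Finset.sum_congr rfl fun π _ => ?_
  simp only [Matrix.submatrix_apply, Matrix.of_apply, complete, Fin.revPerm_apply]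
  rw [Finset.prod_univ_sum, mul_assoc, Finset.sum_mul, mul_left_comm, Finset.mul_sum]
  rw [show ((Equiv.Perm.sign π : ℤ) : MvPolynomial (Fin k) ℂ) =
    MvPolynomial.C ((Equiv.Perm.sign π : ℤ) : ℂ) by simp, ← MvPolynomial.smul_eq_C_mul, map_smul,
    smul_eq_mul, map_sum]
  congr 1
  have hset : ∀ j : Fin k, comps k ((((r (π j).rev : ℕ) + 1 : ℕ) : ℤ) - ((j.rev : ℕ) : ℤ)) =
      comps k (((r (π j).rev : ℕ) : ℤ) + 1 - ((j.rev : ℕ) : ℤ)) := by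
    intro j
    push_cast
    rfl
  simp only [hset]
  refine Finset.sum_congr rfl fun a _ => ?_
  rw [← mul_assoc, Finset.prod_comm, ← Finset.prod_mul_distrib]
  have h2 : ∀ i : Fin k, (MvPolynomial.X i ^ (s i : ℕ) *
      ∏ j, MvPolynomial.X i ^ a j i : MvPolynomial (Fin k) ℂ) =
      MvPolynomial.X i ^ ((s i : ℕ) + ∑ j, a j i) := by
    intro i
    rw [pow_add, Finset.prod_pow_eq_pow_sum]
  simp only [h2]
  rw [evalFunctional_mul_alternant g (fun i => (s i : ℕ) + ∑ j, a j i) fun i => (i : ℕ), bMinor]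
  push_cast
  rfl

end HankelMinor

/-! ### The toggle principle, and chains of integer rows. -/

namespace HankelMinor

open Finset

/-- Each element has a unique failure position, and the toggle there preserves it, so the individual
toggles glue to one involution. A fixed point is harmless, since `f` vanishes on it. -/
theorem sum_eq_zero_of_toggle {α ι : Type*} (S : Finset α) (f : α → ℂ) (P : ι → α → Prop)
    (t : ι → α → α) (ex : ∀ a ∈ S, ∃ i, P i a) (uniq : ∀ a i i', P i a → P i' a → i = i')
    (mem : ∀ a ∈ S, ∀ i, P i a → t i a ∈ S) (pres : ∀ a ∈ S, ∀ i, P i a → P i (t i a))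
    (inv : ∀ a ∈ S, ∀ i, P i a → t i (t i a) = a)
    (neg : ∀ a ∈ S, ∀ i, P i a → f (t i a) = -f a) : ∑ a ∈ S, f a = 0 := by
  classical
  choose c hc using ex
  refine Finset.sum_involution (fun a ha => t (c a ha) a) ?_ ?_ ?_ ?_
  · intro a ha
    rw [neg a ha _ (hc a ha), add_neg_cancel]
  · intro a ha h0 h
    have h1 := neg a ha _ (hc a ha)
    rw [h, self_eq_neg] at h1
    exact h0 h1
  · exact fun a ha => mem a ha _ (hc a ha)
  · intro a ha
    have hm := mem a ha _ (hc a ha)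
    have h1 : c (t (c a ha) a) hm = c a ha :=
      uniq _ _ _ (hc _ hm) (pres a ha _ (hc a ha))
    simp only [h1]
    exact inv a ha _ (hc a ha)

theorem exists_last {p : ℕ → Prop} {k : ℕ} (h : ∃ i < k, p i) :
    ∃ i < k, p i ∧ ∀ i', i < i' → i' < k → ¬p i' := by
  classical
  obtain ⟨i0, h0, hp0⟩ := h
  obtain ⟨i, hi, hmax⟩ := Finset.exists_max_image ((range k).filter p) id ⟨i0, by simp [h0, hp0]⟩
  simp only [mem_filter, mem_range, id] at hi hmax
  exact ⟨i, hi.1, hi.2, fun i' h1 h2 h3 => by have := hmax i' ⟨h2, h3⟩; omega⟩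

theorem exists_first {p : ℕ → Prop} (h : ∃ i, p i) : ∃ i, p i ∧ ∀ i' < i, ¬p i' := by
  classical
  exact ⟨Nat.find h, Nat.find_spec h, fun i' => Nat.find_min h⟩

/-- A chain of `k + 1` rows of `k` integers, extended by zero, each row entrywise at least the
previous one, starting with `y`. -/
structure IsChain (k : ℕ) (y : ℕ → ℤ) (Y : ℕ → ℕ → ℤ) : Prop where
  start : ∀ i < k, Y 0 i = y i
  mono : ∀ j < k, ∀ i < k, Y j i ≤ Y (j + 1) i
  outside : ∀ j i, k < j ∨ k ≤ i → Y j i = 0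

/-- Consecutive rows interlace; the corresponding partitions differ by horizontal strips. -/
def IsStripChain (k : ℕ) (Y : ℕ → ℕ → ℤ) : Prop :=
  ∀ j < k, ∀ i, i + 1 < k → Y (j + 1) (i + 1) < Y j i

/-- The number of letters `j` in the chain. -/
def content (k : ℕ) (Y : ℕ → ℕ → ℤ) (j : ℕ) : ℤ :=
  ∑ i ∈ range k, Y (j + 1) i - ∑ i ∈ range k, Y j i

/-- The number of letters `j + 1` minus the number of letters `j` in the first `r` rows. -/
def excess (Y : ℕ → ℕ → ℤ) (r j : ℕ) : ℤ :=
  ∑ i ∈ range r, (Y (j + 2) i - Y (j + 1) i - (Y (j + 1) i - Y j i))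

/-- In rows `0, …, r` there are at most as many letters `j + 1` as there are letters `j`
in rows `0, …, r - 1`. -/
def IsLatticeChain (k : ℕ) (Y : ℕ → ℕ → ℤ) : Prop :=
  ∀ r < k, ∀ j, j + 1 < k → excess Y r j + (Y (j + 2) r - Y (j + 1) r) ≤ 0

/-! ### The involution on chains that do not interlace. -/

section Pieri

/-- The first level, and in it the last row, where the interlacing condition fails. -/
structure FirstStripFailure (k : ℕ) (q : ℕ × ℕ) (Y : ℕ → ℕ → ℤ) : Prop where
  level_lt : q.1 < k
  row_lt : q.2 + 1 < k
  fails : Y q.1 q.2 ≤ Y (q.1 + 1) (q.2 + 1)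
  before : ∀ j < q.1, ∀ i, i + 1 < k → Y (j + 1) (i + 1) < Y j i
  after : ∀ i, q.2 < i → i + 1 < k → Y (q.1 + 1) (i + 1) < Y q.1 i

/-- Exchange the entries `q.2` and `q.2 + 1` on all levels above `q.1`. -/
def swapAbove (q : ℕ × ℕ) (Y : ℕ → ℕ → ℤ) : ℕ → ℕ → ℤ :=
  fun j i => if q.1 < j then Y j (Equiv.swap q.2 (q.2 + 1) i) else Y j i

variable {k : ℕ} {Y : ℕ → ℕ → ℤ} {q : ℕ × ℕ}

theorem exists_firstStripFailure (h : ¬IsStripChain k Y) : ∃ q, FirstStripFailure k q Y := by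
  unfold IsStripChain at h
  push Not at h
  obtain ⟨j, ⟨hj, i0, hi0, hf0⟩, hmin⟩ := exists_first h
  obtain ⟨i, hi, ⟨hik, hf⟩, hmax⟩ := exists_last
    (p := fun i => i + 1 < k ∧ Y j i ≤ Y (j + 1) (i + 1)) (k := k) ⟨i0, by omega, hi0, hf0⟩
  refine ⟨(j, i), hj, hik, hf, fun j' hj' i' hi' => ?_, fun i' h1 h2 => ?_⟩
  · by_contra hc
    exact hmin j' hj' ⟨by omega, i', hi', not_lt.1 hc⟩
  · by_contra hc
    exact hmax i' h1 (by omega) ⟨h2, not_lt.1 hc⟩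

theorem FirstStripFailure.unique {q' : ℕ × ℕ} (h : FirstStripFailure k q Y)
    (h' : FirstStripFailure k q' Y) : q = q' := by
  obtain ⟨j, i⟩ := q
  obtain ⟨j', i'⟩ := q'
  obtain ⟨a1, a2, a3, a4, a5⟩ := h
  obtain ⟨b1, b2, b3, b4, b5⟩ := h'
  dsimp only at *
  have hj : j = j' := by
    rcases lt_trichotomy j j' with h | h | h
    · have := b4 j h i a2; omega
    · exact h
    · have := a4 j' h i' b2; omega
  subst hj
  have hi : i = i' := by
    rcases lt_trichotomy i i' with h | h | h
    · have := a5 i' h b2; omega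
    · exact h
    · have := b5 i h a2; omega
  rw [hi]

theorem swap_succ_lt {i i' : ℕ} (h : i + 1 < k) (h' : i' < k) : Equiv.swap i (i + 1) i' < k := by
  rw [Equiv.swap_apply_def]
  split_ifs <;> omega

theorem le_swap_succ {i i' : ℕ} (h : i + 1 < k) (h' : k ≤ i') : k ≤ Equiv.swap i (i + 1) i' := by
  rw [Equiv.swap_apply_def]
  split_ifs <;> omega

theorem sum_range_swap_succ {i : ℕ} (h : i + 1 < k) (y : ℕ → ℤ) :
    ∑ x ∈ range k, y (Equiv.swap i (i + 1) x) = ∑ x ∈ range k, y x := by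
  refine Finset.sum_equiv (Equiv.swap i (i + 1)) (fun x => ?_) fun x _ => rfl
  simp only [mem_range]
  refine ⟨swap_succ_lt h, fun hx => ?_⟩
  by_contra hc
  exact absurd hx (not_lt.2 (le_swap_succ h (not_lt.1 hc)))

theorem swapAbove_swapAbove : swapAbove q (swapAbove q Y) = Y := by
  funext j i
  unfold swapAbove
  split_ifs <;> simp

theorem sum_swapAbove (h : q.2 + 1 < k) (j : ℕ) :
    ∑ i ∈ range k, swapAbove q Y j i = ∑ i ∈ range k, Y j i := by
  unfold swapAbove
  split_ifs
  · exact sum_range_swap_succ h _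
  · rfl

theorem IsChain.lt_of_strip {y : ℕ → ℤ} (hY : IsChain k y Y)
    (hy : ∀ i, i + 1 < k → y (i + 1) < y i) {j : ℕ} (hj : j ≤ k)
    (h : ∀ j' < j, ∀ i, i + 1 < k → Y (j' + 1) (i + 1) < Y j' i) {i : ℕ} (hi : i + 1 < k) :
    Y j (i + 1) < Y j i := by
  cases j with
  | zero =>
    rw [hY.start _ hi, hY.start _ (by omega)]
    exact hy i hi
  | succ j => exact (h j (by omega) i hi).trans_le (hY.mono j (by omega) i (by omega))

theorem IsChain.swapAbove {y : ℕ → ℤ} (hY : IsChain k y Y)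
    (hy : ∀ i, i + 1 < k → y (i + 1) < y i) (hq : FirstStripFailure k q Y) :
    IsChain k y (swapAbove q Y) := by
  obtain ⟨j, i⟩ := q
  obtain ⟨h1, h2, h3, h4, h5⟩ := hq
  dsimp only at *
  have hlt := hY.lt_of_strip hy h1.le h4 h2
  constructor
  · intro i' hi'
    simp only [HankelMinor.swapAbove, not_lt_zero, if_false]
    exact hY.start i' hi'
  · intro j' hj' i' hi'
    simp only [HankelMinor.swapAbove]
    rcases lt_trichotomy j j' with h | h | h
    · rw [if_pos h, if_pos (by omega)]
      exact hY.mono j' hj' _ (swap_succ_lt h2 hi')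
    · subst h
      -- At the level of the swap, row `i` may take the entry of row `i + 1` exactly because
      -- interlacing fails there. The opposite exchange is allowed because level `j` is still
      -- strictly decreasing.
      rw [if_neg (lt_irrefl _), if_pos (Nat.lt_succ_self _), Equiv.swap_apply_def]
      split_ifs with e1 e2
      · rw [e1]; exact h3
      · rw [e2]; exact hlt.le.trans (hY.mono j hj' i (by omega))
      · exact hY.mono j hj' i' hi'
    · rw [if_neg (by omega), if_neg (by omega)]
      exact hY.mono j' hj' i' hi'
  · intro j' i' h
    simp only [HankelMinor.swapAbove]
    split_ifs
    · exact hY.outside _ _ (h.imp_right (le_swap_succ h2))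
    · exact hY.outside _ _ h

/-- The choice of first level and last row makes the position stable: the tests on earlier levels
and in later rows of this level do not see the swapped entries. The failure itself becomes
monotonicity of the original chain. -/
theorem FirstStripFailure.swapAbove {y : ℕ → ℤ} (hY : IsChain k y Y)
    (hq : FirstStripFailure k q Y) : FirstStripFailure k q (swapAbove q Y) := by
  obtain ⟨j, i⟩ := q
  obtain ⟨h1, h2, h3, h4, h5⟩ := hq
  dsimp only at *
  refine ⟨h1, h2, ?_, fun j' hj' i' hi' => ?_, fun i' hi' hk' => ?_⟩
  · simp only [HankelMinor.swapAbove, lt_irrefl, if_false, Nat.lt_succ_self, if_true,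
      Equiv.swap_apply_right]
    exact hY.mono j h1 i (by omega)
  · simp only [HankelMinor.swapAbove]
    rw [if_neg (by omega), if_neg (by omega)]
    exact h4 j' hj' i' hi'
  · simp only [HankelMinor.swapAbove, lt_irrefl, if_false, Nat.lt_succ_self, if_true]
    rw [Equiv.swap_apply_of_ne_of_ne (by omega) (by omega)]
    exact h5 i' hi' hk'

end Pieri

end HankelMinor

/-! ### The involution on interlacing chains that violate the lattice condition. -/

namespace HankelMinor

open Finset

section Lattice

/-- The least value in row `i` of a row interlacing between `μ` and `ν`. -/
def lowerBound (k : ℕ) (μ ν : ℕ → ℤ) (i : ℕ) : ℤ :=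
  if i + 1 < k then max (μ i) (ν (i + 1) + 1) else μ i

/-- The greatest value in row `i`, below the top row, of a row interlacing between `μ` and `ν`. -/
def upperBound (μ ν : ℕ → ℤ) (i : ℕ) : ℤ :=
  min (ν i) (μ (i - 1) - 1)

/-- An instance of max + min = sum, since both bounds compare μ i with ν (i+1) + 1. -/
theorem lowerBound_add_upperBound {k i : ℕ} (μ ν : ℕ → ℤ) (h : i + 1 < k) :
    lowerBound k μ ν i + upperBound μ ν (i + 1) = μ i + ν (i + 1) := by
  simp only [lowerBound, if_pos h, upperBound, Nat.add_sub_cancel]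
  omega

/-- Reflect the rows of `κ` from row `r` on, where row `r` is only reflected in the part left of
the box in which the content of the reading word becomes unbalanced; `e` is the excess of the
rows above. -/
def reflectFrom (k : ℕ) (μ ν : ℕ → ℤ) (r : ℕ) (e : ℤ) (κ : ℕ → ℤ) (i : ℕ) : ℤ :=
  if i < r then κ i
  else if i = r then lowerBound k μ ν r + (ν r - 1 + e) - κ r
  else if i < k then lowerBound k μ ν i + upperBound μ ν i - κ i
  else κ i

theorem reflectFrom_reflectFrom (k : ℕ) (μ ν : ℕ → ℤ) (r : ℕ) (e : ℤ) (κ : ℕ → ℤ) :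
    reflectFrom k μ ν r e (reflectFrom k μ ν r e κ) = κ := by
  funext i
  simp only [reflectFrom]
  split_ifs <;> (try subst_vars) <;> simp_all

/-- The upper bound of each row pairs with the lower bound of the row above, so the sum telescopes
to one remaining lower bound. The excess in row `r` compensates the unreflected rows above it. In
the bottom row the remaining bound is μ. -/
theorem sum_reflectFrom_aux {k r : ℕ} (μ ν κ : ℕ → ℤ) (m : ℕ) (hm : r + m < k) :
    ∑ i ∈ range (r + m + 1), (reflectFrom k μ ν r (∑ i ∈ range r, (ν i - κ i - (κ i - μ i))) κ i
        + κ i) =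
      ∑ i ∈ range (r + m + 1), ν i + ∑ i ∈ range (r + m), μ i - 1 +
        lowerBound k μ ν (r + m) := by
  induction m with
  | zero =>
    rw [Nat.add_zero, sum_range_succ, sum_range_succ ν r]
    have h : ∑ i ∈ range r, (reflectFrom k μ ν r (∑ i ∈ range r, (ν i - κ i - (κ i - μ i))) κ i
        + κ i) = ∑ i ∈ range r, (κ i + κ i) := by
      refine sum_congr rfl fun i hi => ?_
      rw [reflectFrom, if_pos (mem_range.1 hi)]
    rw [h, reflectFrom, if_neg (lt_irrefl r), if_pos rfl]
    simp only [sum_sub_distrib, sum_add_distrib]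
    ring_nf
  | succ m ih =>
    rw [← Nat.add_assoc] at hm ⊢
    rw [sum_range_succ, ih (by omega), sum_range_succ ν (r + m + 1), sum_range_succ μ (r + m),
      reflectFrom, if_neg (by omega), if_neg (by omega), if_pos hm]
    linarith [lowerBound_add_upperBound μ ν hm]

theorem sum_reflectFrom {k r : ℕ} (μ ν κ : ℕ → ℤ) (hr : r < k) :
    ∑ i ∈ range k, reflectFrom k μ ν r (∑ i ∈ range r, (ν i - κ i - (κ i - μ i))) κ i =
      ∑ i ∈ range k, ν i + ∑ i ∈ range k, μ i - ∑ i ∈ range k, κ i - 1 := by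
  obtain ⟨m, rfl⟩ : ∃ m, k = r + m + 1 := ⟨k - 1 - r, by omega⟩
  have h := sum_reflectFrom_aux (r := r) (k := r + m + 1) μ ν κ m (by omega)
  rw [sum_add_distrib, lowerBound, if_neg (by omega)] at h
  rw [sum_range_succ μ]
  linarith

/-- The first row `q.1`, and in it the last letter `q.2`, where the lattice condition fails. -/
structure FirstLatticeFailure (k : ℕ) (q : ℕ × ℕ) (Y : ℕ → ℕ → ℤ) : Prop where
  row_lt : q.1 < k
  letter_lt : q.2 + 1 < k
  fails : 0 < excess Y q.1 q.2 + (Y (q.2 + 2) q.1 - Y (q.2 + 1) q.1)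
  before : ∀ r < q.1, ∀ j, j + 1 < k → excess Y r j + (Y (j + 2) r - Y (j + 1) r) ≤ 0
  after : ∀ j, q.2 < j → j + 1 < k → excess Y q.1 j + (Y (j + 2) q.1 - Y (j + 1) q.1) ≤ 0

/-- Reflect the level between the letters `q.2` and `q.2 + 1` from row `q.1` on. -/
def reflectLevel (k : ℕ) (q : ℕ × ℕ) (Y : ℕ → ℕ → ℤ) : ℕ → ℕ → ℤ :=
  fun j i => if j = q.2 + 1 then
    reflectFrom k (Y q.2) (Y (q.2 + 2)) q.1 (excess Y q.1 q.2) (Y (q.2 + 1)) i else Y j i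

variable {k : ℕ} {Y : ℕ → ℕ → ℤ} {q : ℕ × ℕ}

theorem exists_firstLatticeFailure (h : ¬IsLatticeChain k Y) :
    ∃ q, FirstLatticeFailure k q Y := by
  unfold IsLatticeChain at h
  push Not at h
  obtain ⟨r, ⟨hr, j0, hj0, hf0⟩, hmin⟩ := exists_first h
  obtain ⟨j, hj, ⟨hjk, hf⟩, hmax⟩ := exists_last
    (p := fun j => j + 1 < k ∧ 0 < excess Y r j + (Y (j + 2) r - Y (j + 1) r)) (k := k)
    ⟨j0, by omega, hj0, hf0⟩
  refine ⟨(r, j), hr, hjk, hf, fun r' hr' j' hj' => ?_, fun j' h1 h2 => ?_⟩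
  · by_contra hc
    exact hmin r' hr' ⟨hr'.trans hr, j', hj', not_le.1 hc⟩
  · by_contra hc
    exact hmax j' h1 (by omega) ⟨h2, not_le.1 hc⟩

theorem FirstLatticeFailure.unique {q' : ℕ × ℕ} (h : FirstLatticeFailure k q Y)
    (h' : FirstLatticeFailure k q' Y) : q = q' := by
  obtain ⟨r, j⟩ := q
  obtain ⟨r', j'⟩ := q'
  obtain ⟨a1, a2, a3, a4, a5⟩ := h
  obtain ⟨b1, b2, b3, b4, b5⟩ := h'
  dsimp only at *
  have hr : r = r' := by
    rcases lt_trichotomy r r' with h | h | h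
    · have := b4 r h j a2; omega
    · exact h
    · have := a4 r' h j' b2; omega
  subst hr
  have hj : j = j' := by
    rcases lt_trichotomy j j' with h | h | h
    · have := a5 j' h b2; omega
    · exact h
    · have := b5 j h a2; omega
  rw [hj]

theorem reflectLevel_of_ne {j : ℕ} (h : j ≠ q.2 + 1) : reflectLevel k q Y j = Y j := by
  funext i
  rw [reflectLevel, if_neg h]

theorem reflectLevel_mid : reflectLevel k q Y (q.2 + 1) =
    reflectFrom k (Y q.2) (Y (q.2 + 2)) q.1 (excess Y q.1 q.2) (Y (q.2 + 1)) := by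
  funext i
  rw [reflectLevel, if_pos rfl]

theorem reflectLevel_of_lt {j i : ℕ} (h : i < q.1) : reflectLevel k q Y j i = Y j i := by
  rw [reflectLevel]
  split_ifs with hj
  · rw [reflectFrom, if_pos h, hj]
  · rfl

theorem excess_reflectLevel {r j : ℕ} (h : r ≤ q.1) :
    excess (reflectLevel k q Y) r j = excess Y r j := by
  refine sum_congr rfl fun i hi => ?_
  have hi : i < q.1 := (mem_range.1 hi).trans_le h
  rw [reflectLevel_of_lt hi, reflectLevel_of_lt hi, reflectLevel_of_lt hi]

theorem reflectLevel_reflectLevel : reflectLevel k q (reflectLevel k q Y) = Y := by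
  funext j
  by_cases hj : j = q.2 + 1
  · subst hj
    rw [reflectLevel_mid, reflectLevel_of_ne (by omega), reflectLevel_of_ne (by omega),
      excess_reflectLevel le_rfl, reflectLevel_mid, reflectFrom_reflectFrom]
  · rw [reflectLevel_of_ne hj, reflectLevel_of_ne hj]

theorem sum_reflectLevel_mid (h : q.1 < k) :
    ∑ i ∈ range k, reflectLevel k q Y (q.2 + 1) i =
      ∑ i ∈ range k, Y (q.2 + 2) i + ∑ i ∈ range k, Y q.2 i - ∑ i ∈ range k, Y (q.2 + 1) i - 1 := by
  rw [reflectLevel_mid]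
  exact sum_reflectFrom _ _ _ h

/-- The bounds that make the reflected level interlace with its neighbours. -/
theorem FirstLatticeFailure.bounds {y : ℕ → ℤ} (hY : IsChain k y Y) (hs : IsStripChain k Y)
    (hq : FirstLatticeFailure k q Y) {i : ℕ} (hi : i < k) :
    Y q.2 i ≤ reflectLevel k q Y (q.2 + 1) i ∧
      reflectLevel k q Y (q.2 + 1) i ≤ Y (q.2 + 2) i ∧
      (i + 1 < k → Y (q.2 + 2) (i + 1) < reflectLevel k q Y (q.2 + 1) i) ∧
      (∀ i', i = i' + 1 → reflectLevel k q Y (q.2 + 1) i < Y q.2 i') ∧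
      (i = q.1 → 0 < excess Y q.1 q.2 + (Y (q.2 + 2) i - reflectLevel k q Y (q.2 + 1) i)) := by
  obtain ⟨r, j⟩ := q
  obtain ⟨h1, h2, h3, h4, h5⟩ := hq
  dsimp only at *
  have m1 := hY.mono j (by omega) i hi
  have m2 : Y (j + 1) i ≤ Y (j + 2) i := hY.mono (j + 1) (by omega) i hi
  have s1 : i + 1 < k → Y (j + 2) (i + 1) < Y (j + 1) i := hs (j + 1) h2 i
  have s2 : ∀ i', i = i' + 1 → Y (j + 1) i < Y j i' := by
    rintro i' rfl
    exact hs j (by omega) i' hi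
  rw [show reflectLevel k (r, j) Y (j + 1) i = _ from congrFun (reflectLevel_mid (q := (r, j))) i]
  dsimp only
  have hlow : Y j i ≤ lowerBound k (Y j) (Y (j + 2)) i ∧
      lowerBound k (Y j) (Y (j + 2)) i ≤ Y (j + 1) i ∧
      (i + 1 < k → Y (j + 2) (i + 1) < lowerBound k (Y j) (Y (j + 2)) i) := by
    unfold lowerBound
    split_ifs with h
    · have := s1 h
      omega
    · omega
  rcases lt_trichotomy i r with h | h | h
  · rw [reflectFrom, if_pos h]
    exact ⟨m1, m2, s1, s2, fun h' => by omega⟩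
  · subst h
    -- As row `i - 1` passes the lattice test, the excess is at most minus the number of letters `j`
    -- in that row. Hence the truncated upper end ν i - 1 + e lies below both ν i and μ (i-1).
    have hex : excess Y i j ≤ 0 ∧ ∀ i', i = i' + 1 →
        Y (j + 2) i + excess Y i j ≤ Y j i' := by
      cases i with
      | zero => simp [excess]
      | succ i =>
        have e1 := h4 i (Nat.lt_succ_self i) j h2
        have e2 : excess Y (i + 1) j = excess Y i j +
          (Y (j + 2) i - Y (j + 1) i - (Y (j + 1) i - Y j i)) := sum_range_succ _ _
        have e3 := hY.mono j (by omega) i (by omega)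
        have e4 : Y (j + 2) (i + 1) < Y (j + 1) i := hs (j + 1) h2 i hi
        refine ⟨by omega, ?_⟩
        intro i' hi'
        obtain rfl : i = i' := by omega
        omega
    rw [reflectFrom, if_neg (lt_irrefl i), if_pos rfl]
    refine ⟨by omega, by omega, by omega, fun i' hi' => ?_, by omega⟩
    have := hex.2 i' hi'
    omega
  · have hup : Y (j + 1) i ≤ upperBound (Y j) (Y (j + 2)) i ∧
        upperBound (Y j) (Y (j + 2)) i ≤ Y (j + 2) i ∧
        ∀ i', i = i' + 1 → upperBound (Y j) (Y (j + 2)) i < Y j i' := by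
      have := s2 (i - 1) (by omega)
      unfold upperBound
      refine ⟨by omega, by omega, ?_⟩
      rintro i' rfl
      rw [Nat.add_sub_cancel]
      omega
    rw [reflectFrom, if_neg (by omega), if_neg (by omega), if_pos hi]
    refine ⟨by omega, by omega, by omega, fun i' hi' => ?_, by omega⟩
    have := hup.2.2 i' hi'
    omega

theorem IsChain.reflectLevel {y : ℕ → ℤ} (hY : IsChain k y Y) (hs : IsStripChain k Y)
    (hq : FirstLatticeFailure k q Y) : IsChain k y (reflectLevel k q Y) := by
  have hb := fun {i} => hq.bounds hY hs (i := i)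
  have hr := hq.row_lt
  have hl := hq.letter_lt
  constructor
  · intro i hi
    rw [reflectLevel_of_ne (by omega)]
    exact hY.start i hi
  · intro j hj i hi
    by_cases e1 : j = q.2 + 1
    · subst e1
      rw [reflectLevel_of_ne (j := q.2 + 1 + 1) (by omega)]
      exact (hb hi).2.1
    · by_cases e2 : j = q.2
      · subst e2
        rw [reflectLevel_of_ne (j := q.2) (by omega)]
        exact (hb hi).1
      · rw [reflectLevel_of_ne (j := j) e1, reflectLevel_of_ne (by omega)]
        exact hY.mono j hj i hi
  · intro j i h
    by_cases e1 : j = q.2 + 1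
    · subst e1
      have hi : k ≤ i := by omega
      rw [reflectLevel_mid, reflectFrom, if_neg (by omega), if_neg (by omega), if_neg (by omega)]
      exact hY.outside _ _ h
    · rw [reflectLevel_of_ne e1]
      exact hY.outside _ _ h

theorem IsStripChain.reflectLevel {y : ℕ → ℤ} (hY : IsChain k y Y) (hs : IsStripChain k Y)
    (hq : FirstLatticeFailure k q Y) : IsStripChain k (reflectLevel k q Y) := by
  have hb := fun {i} => hq.bounds hY hs (i := i)
  have hl := hq.letter_lt
  intro j hj i hi
  by_cases e1 : j = q.2 + 1
  · subst e1
    rw [reflectLevel_of_ne (j := q.2 + 1 + 1) (by omega)]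
    exact (hb (by omega)).2.2.1 hi
  · by_cases e2 : j = q.2
    · subst e2
      rw [reflectLevel_of_ne (j := q.2) (by omega)]
      exact (hb hi).2.2.2.1 i rfl
    · rw [reflectLevel_of_ne (j := j) e1, reflectLevel_of_ne (by omega)]
      exact hs j hj i hi

/-- Rows above `q.1` are untouched, and in row `q.1` the tests for letters after `q.2` involve only
levels above the reflected one; this is why the last failing letter is chosen. Truncating the
reflection in row `q.1` keeps the failure itself. -/
theorem FirstLatticeFailure.reflectLevel {y : ℕ → ℤ} (hY : IsChain k y Y)
    (hs : IsStripChain k Y) (hq : FirstLatticeFailure k q Y) :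
    FirstLatticeFailure k q (reflectLevel k q Y) := by
  refine ⟨hq.row_lt, hq.letter_lt, ?_, fun r hr j hj => ?_, fun j hj hjk => ?_⟩
  · rw [excess_reflectLevel le_rfl, reflectLevel_of_ne (j := q.2 + 2) (by omega)]
    exact (hq.bounds hY hs hq.row_lt).2.2.2.2 rfl
  · rw [excess_reflectLevel hr.le, reflectLevel_of_lt hr, reflectLevel_of_lt hr]
    exact hq.before r hr j hj
  · rw [excess_reflectLevel le_rfl, reflectLevel_of_ne (by omega), reflectLevel_of_ne (by omega)]
    exact hq.after j hj hjk

end Lattice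

end HankelMinor

/-! ### Cancellation in the signed sum over chains. -/

namespace HankelMinor

open Finset

section Cancellation

variable {k : ℕ} {y : ℕ → ℤ} {R : Fin k → ℤ}

/-- The content of `Y` is the rearrangement of `R` by `π`, shifted by the staircase. -/
def HasContent (R : Fin k → ℤ) (π : Equiv.Perm (Fin k)) (Y : ℕ → ℕ → ℤ) : Prop :=
  ∀ j : Fin k, content k Y j = R (π j) - ((j.rev : ℕ) : ℤ)

theorem HasContent.swapAbove {π : Equiv.Perm (Fin k)} {Y : ℕ → ℕ → ℤ} (h : HasContent R π Y)
    {q : ℕ × ℕ} (hq : q.2 + 1 < k) : HasContent R π (swapAbove q Y) := by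
  intro j
  rw [content, sum_swapAbove hq, sum_swapAbove hq]
  exact h j

/-- Reflection exchanges the numbers of the two letters up to a shift by one. The staircase absorbs
this shift, so the effect is an adjacent transposition in π. -/
theorem HasContent.reflectLevel {π : Equiv.Perm (Fin k)} {Y : ℕ → ℕ → ℤ} (h : HasContent R π Y)
    {q : ℕ × ℕ} (hr : q.1 < k) (hj : q.2 + 1 < k) :
    HasContent R (π * Equiv.swap ⟨q.2, by omega⟩ ⟨q.2 + 1, hj⟩) (reflectLevel k q Y) := by
  intro j
  have hm := sum_reflectLevel_mid (Y := Y) hr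
  have h0 := h ⟨q.2, by omega⟩
  have h1 := h ⟨q.2 + 1, hj⟩
  simp only [content, Fin.val_rev] at h0 h1 ⊢
  rw [Equiv.Perm.mul_apply, Equiv.swap_apply_def]
  split_ifs with e1 e2
  · subst e1
    dsimp only
    rw [hm, reflectLevel_of_ne (j := q.2) (by omega)]
    have h1' : ∑ i ∈ range k, Y (q.2 + 2) i - ∑ i ∈ range k, Y (q.2 + 1) i = _ := h1
    omega
  · subst e2
    dsimp only
    rw [hm, reflectLevel_of_ne (j := q.2 + 1 + 1) (by omega)]
    have h1' : ∑ i ∈ range k, Y (q.2 + 2) i - ∑ i ∈ range k, Y (q.2 + 1) i = _ := h1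
    have e3 : ∑ i ∈ range k, Y (q.2 + 1 + 1) i = ∑ i ∈ range k, Y (q.2 + 2) i := rfl
    omega
  · have e3 : (j : ℕ) ≠ q.2 := fun h => e1 (Fin.ext h)
    have e4 : (j : ℕ) ≠ q.2 + 1 := fun h => e2 (Fin.ext h)
    rw [reflectLevel_of_ne (j := (j : ℕ)) e4, reflectLevel_of_ne (by omega)]
    simpa [content] using h j

theorem sum_not_strip_eq_zero (hy : ∀ i, i + 1 < k → y (i + 1) < y i) (B : (ℕ → ℤ) → ℂ)
    (hB : ∀ z i, i + 1 < k → B (fun x => z (Equiv.swap i (i + 1) x)) = -B z)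
    (S : Finset (Equiv.Perm (Fin k) × (ℕ → ℕ → ℤ)))
    (hS : ∀ x, x ∈ S ↔ (IsChain k y x.2 ∧ HasContent R x.1 x.2) ∧ ¬IsStripChain k x.2) :
    ∑ x ∈ S, ((Equiv.Perm.sign x.1 : ℤ) : ℂ) * B (x.2 k) = 0 := by
  refine sum_eq_zero_of_toggle S _ (fun q x => FirstStripFailure k q x.2)
    (fun q x => (x.1, swapAbove q x.2)) ?_ ?_ ?_ ?_ ?_ ?_
  · intro x hx
    exact exists_firstStripFailure ((hS x).1 hx).2
  · intro x q q' h h'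
    exact h.unique h'
  · intro x hx q hq
    obtain ⟨⟨h1, h2⟩, -⟩ := (hS x).1 hx
    refine (hS _).2 ⟨⟨h1.swapAbove hy hq, h2.swapAbove hq.row_lt⟩, fun h => ?_⟩
    have h3 := hq.swapAbove h1
    exact absurd (h q.1 hq.level_lt q.2 hq.row_lt) (not_lt.2 h3.fails)
  · intro x hx q hq
    exact hq.swapAbove ((hS x).1 hx).1.1
  · intro x _ q _
    exact Prod.ext rfl swapAbove_swapAbove
  · intro x _ q hq
    have h : swapAbove q x.2 k = fun i => x.2 k (Equiv.swap q.2 (q.2 + 1) i) := by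
      funext i
      rw [swapAbove, if_pos hq.level_lt]
    dsimp only
    rw [h, hB _ _ hq.row_lt, mul_neg]

theorem sum_not_lattice_eq_zero (B : (ℕ → ℤ) → ℂ)
    (S : Finset (Equiv.Perm (Fin k) × (ℕ → ℕ → ℤ)))
    (hS : ∀ x, x ∈ S ↔ ((IsChain k y x.2 ∧ HasContent R x.1 x.2) ∧ IsStripChain k x.2) ∧
      ¬IsLatticeChain k x.2) :
    ∑ x ∈ S, ((Equiv.Perm.sign x.1 : ℤ) : ℂ) * B (x.2 k) = 0 := by
  refine sum_eq_zero_of_toggle S _ (fun q x => FirstLatticeFailure k q x.2)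
    (fun q x => (x.1 * if hj : q.2 + 1 < k then Equiv.swap ⟨q.2, by omega⟩ ⟨q.2 + 1, hj⟩
      else (1 : Equiv.Perm (Fin k)),
      reflectLevel k q x.2)) ?_ ?_ ?_ ?_ ?_ ?_
  · intro x hx
    exact exists_firstLatticeFailure ((hS x).1 hx).2
  · intro x q q' h h'
    exact h.unique h'
  · intro x hx q hq
    obtain ⟨⟨⟨h1, h2⟩, h3⟩, -⟩ := (hS x).1 hx
    simp only [dif_pos hq.letter_lt]
    refine (hS _).2 ⟨⟨⟨h1.reflectLevel h3 hq, h2.reflectLevel hq.row_lt hq.letter_lt⟩,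
      h3.reflectLevel h1 hq⟩, fun h => ?_⟩
    have h4 := hq.reflectLevel h1 h3
    exact absurd (h q.1 hq.row_lt q.2 hq.letter_lt) (not_le.2 h4.fails)
  · intro x hx q hq
    exact hq.reflectLevel ((hS x).1 hx).1.1.1 ((hS x).1 hx).1.2
  · intro x _ q hq
    refine Prod.ext ?_ reflectLevel_reflectLevel
    simp only [dif_pos hq.letter_lt, mul_assoc, Equiv.swap_mul_self, mul_one]
  · intro x _ q hq
    have hl := hq.letter_lt
    dsimp only
    -- The reflected level lies strictly below `k`, so the last row is kept and the sign comes from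
    -- π alone.
    rw [dif_pos hl, reflectLevel_of_ne (by omega), Equiv.Perm.sign_mul,
      Equiv.Perm.sign_swap (by simp)]
    simp

/-- The content of a lattice chain is a partition. -/
theorem IsLatticeChain.content_le {Y : ℕ → ℕ → ℤ} (hY : IsChain k y Y) (hl : IsLatticeChain k Y)
    {j : ℕ} (hj : j + 1 < k) : content k Y (j + 1) ≤ content k Y j := by
  obtain ⟨m, rfl⟩ : ∃ m, k = m + 1 := ⟨k - 1, by omega⟩
  have h := hl m (by omega) j hj
  have h1 := hY.mono j (by omega) m (by omega)
  simp only [excess, content, sum_sub_distrib, sum_range_succ] at h ⊢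
  have e3 : ∑ i ∈ range m, Y (j + 1 + 1) i = ∑ i ∈ range m, Y (j + 2) i := rfl
  have e4 : Y (j + 1 + 1) m = Y (j + 2) m := rfl
  omega

/-- The content of a lattice chain decreases weakly; adding the staircase back makes R ∘ π strictly
decreasing, so π is increasing. -/
theorem perm_eq_one_of_lattice {π : Equiv.Perm (Fin k)} {Y : ℕ → ℕ → ℤ} (hR : StrictAnti R)
    (hY : IsChain k y Y) (hc : HasContent R π Y) (hl : IsLatticeChain k Y) : π = 1 := by
  have hmono : StrictMono π := by
    cases k with
    | zero => exact fun i => i.elim0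
    | succ n =>
      refine Fin.strictMono_iff_lt_succ.2 fun i => ?_
      have h := hl.content_le hY (j := i) (by omega)
      have h1 := hc i.succ
      have h2 := hc i.castSucc
      simp only [Fin.val_succ, Fin.val_castSucc, Fin.val_rev] at h1 h2
      rw [h1, h2] at h
      refine hR.lt_iff_gt.1 ?_
      omega
  ext i
  have := (StrictMono.range_inj hmono strictMono_id).1 (by simp)
  simp [this]

open Classical in
theorem sum_signed_chains (hy : ∀ i, i + 1 < k → y (i + 1) < y i) (hR : StrictAnti R)
    (B : (ℕ → ℤ) → ℂ) (hB : ∀ z i, i + 1 < k → B (fun x => z (Equiv.swap i (i + 1) x)) = -B z)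
    (S : Finset (Equiv.Perm (Fin k) × (ℕ → ℕ → ℤ)))
    (hS : ∀ x, x ∈ S ↔ IsChain k y x.2 ∧ HasContent R x.1 x.2) (T : Finset (ℕ → ℕ → ℤ))
    (hT : ∀ Y, Y ∈ T ↔ (IsChain k y Y ∧ HasContent R 1 Y) ∧ IsStripChain k Y ∧
      IsLatticeChain k Y) :
    ∑ x ∈ S, ((Equiv.Perm.sign x.1 : ℤ) : ℂ) * B (x.2 k) = ∑ Y ∈ T, B (Y k) := by
  rw [← sum_filter_add_sum_filter_not S (fun x => IsStripChain k x.2),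
    sum_not_strip_eq_zero (R := R) hy B hB (S.filter fun x => ¬IsStripChain k x.2)
      (fun x => by rw [mem_filter, hS]), add_zero,
    ← sum_filter_add_sum_filter_not (S.filter _) (fun x => IsLatticeChain k x.2),
    sum_not_lattice_eq_zero (y := y) (R := R) B
      ((S.filter fun x => IsStripChain k x.2).filter fun x => ¬IsLatticeChain k x.2)
      (fun x => by rw [mem_filter, mem_filter, hS]), add_zero]
  have hone : ∀ x ∈ (S.filter fun x => IsStripChain k x.2).filter fun x => IsLatticeChain k x.2,
      x.1 = 1 := by
    intro x hx
    rw [mem_filter, mem_filter, hS] at hx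
    exact perm_eq_one_of_lattice hR hx.1.1.1 hx.1.1.2 hx.2
  refine sum_bij (fun x _ => x.2) ?_ ?_ ?_ ?_
  · intro x hx
    have h1 := hone x hx
    rw [mem_filter, mem_filter, hS, h1] at hx
    exact (hT _).2 ⟨hx.1.1, hx.1.2, hx.2⟩
  · intro x hx x' hx' h
    exact Prod.ext ((hone x hx).trans (hone x' hx').symm) h
  · intro Y hY
    rw [hT] at hY
    refine ⟨(1, Y), ?_, rfl⟩
    rw [mem_filter, mem_filter, hS]
    exact ⟨⟨hY.1, hY.2.1⟩, hY.2.2⟩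
  · intro x hx
    rw [hone x hx]
    simp

end Cancellation

end HankelMinor

/-! ### From exponent matrices to chains. -/

namespace HankelMinor

open Finset

/-- The tuple `p` in reverse order, extended by zero. -/
def revTuple {k : ℕ} (p : Fin k → ℤ) (i : ℕ) : ℤ :=
  if h : i < k then p (Fin.rev ⟨i, h⟩) else 0

theorem revTuple_val {k : ℕ} (p : Fin k → ℤ) (i : Fin k) : revTuple p i = p i.rev := by
  rw [revTuple, dif_pos i.2]

section ChainOfMatrix

variable {k : ℕ} {y : ℕ → ℤ}

/-- The chain starting at `y` whose step `j` adds the reversed tuple `a j`. -/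
def chainOf (y : ℕ → ℤ) (a : Fin k → Fin k → ℕ) (j i : ℕ) : ℤ :=
  if j ≤ k ∧ i < k then
    y i + ∑ j' ∈ range j, if h : j' < k then revTuple (fun i => (a ⟨j', h⟩ i : ℤ)) i else 0
  else 0

theorem chainOf_zero (a : Fin k → Fin k → ℕ) {i : ℕ} (hi : i < k) : chainOf y a 0 i = y i := by
  simp [chainOf, hi]

theorem chainOf_succ (a : Fin k → Fin k → ℕ) (j i : Fin k) :
    chainOf y a (j + 1) i = chainOf y a j i + a j i.rev := by
  rw [chainOf, chainOf, if_pos ⟨j.2, i.2⟩, if_pos ⟨j.2.le, i.2⟩, sum_range_succ, dif_pos j.2,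
    revTuple_val, add_assoc]

theorem chainOf_last (a : Fin k → Fin k → ℕ) (i : Fin k) :
    chainOf y a k i = y i + ∑ j, (a j i.rev : ℤ) := by
  rw [chainOf, if_pos ⟨le_rfl, i.2⟩, sum_range]
  simp [revTuple_val]

theorem isChain_chainOf (a : Fin k → Fin k → ℕ) : IsChain k y (chainOf y a) := by
  refine ⟨fun i hi => chainOf_zero a hi, fun j hj i hi => ?_, fun j i h => ?_⟩
  · have := chainOf_succ (y := y) a ⟨j, hj⟩ ⟨i, hi⟩
    dsimp only at this
    omega
  · rw [chainOf, if_neg (by omega)]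

theorem content_chainOf (a : Fin k → Fin k → ℕ) (j : Fin k) :
    content k (chainOf y a) j = ∑ i, (a j i : ℤ) := by
  rw [content, sum_range, sum_range, ← sum_sub_distrib]
  simp only [chainOf_succ, add_sub_cancel_left]
  exact Equiv.sum_comp Fin.revPerm fun i => (a j i : ℤ)

theorem chainOf_injective : Function.Injective (chainOf (k := k) y) := by
  intro a b h
  funext j i
  have h1 := chainOf_succ (y := y) a j i.rev
  have h2 := chainOf_succ (y := y) b j i.rev
  rw [h, h2, Fin.rev_rev] at h1
  omega

theorem IsChain.exists_eq_chainOf {Y : ℕ → ℕ → ℤ} (hY : IsChain k y Y) :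
    ∃ a : Fin k → Fin k → ℕ, Y = chainOf y a := by
  refine ⟨fun j i => (Y (j + 1) (i.rev : ℕ) - Y j (i.rev : ℕ)).toNat, ?_⟩
  have key : ∀ j ≤ k, ∀ i : Fin k, Y j i = chainOf y
      (fun j i : Fin k => (Y (j + 1) (i.rev : ℕ) - Y j (i.rev : ℕ)).toNat) j i := by
    intro j
    induction j with
    | zero => exact fun _ i => (hY.start i i.2).trans (chainOf_zero _ i.2).symm
    | succ j ih =>
      intro hj i
      have h1 := chainOf_succ (y := y)
        (fun j i : Fin k => (Y (j + 1) (i.rev : ℕ) - Y j (i.rev : ℕ)).toNat) ⟨j, hj⟩ i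
      have h2 := hY.mono j hj i i.2
      dsimp only at h1
      rw [h1, ← ih (by omega), Fin.rev_rev]
      omega
  funext j i
  by_cases h : j ≤ k ∧ i < k
  · exact key j h.1 ⟨i, h.2⟩
  · rw [hY.outside j i (by omega), chainOf, if_neg h]

end ChainOfMatrix

theorem bMinor_comp_swap (g : ℤ → ℂ) {k : ℕ} (z : ℕ → ℤ) {i : ℕ} (hi : i + 1 < k) :
    bMinor g (fun x : Fin k => z (Equiv.swap i (i + 1) (x.rev : ℕ))) =
      -bMinor g (fun x : Fin k => z (x.rev : ℕ)) := by
  set a : Fin k := Fin.rev ⟨i, by omega⟩ with ha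
  set b : Fin k := Fin.rev ⟨i + 1, hi⟩ with hb
  have hab : a ≠ b := by
    simp [ha, hb]
  have h := Matrix.det_permute' (Equiv.swap a b)
    (Matrix.of fun c x : Fin k => g (z (x.rev : ℕ) + (c : ℤ)))
  rw [Equiv.Perm.sign_swap hab] at h
  simp only [Units.val_neg, Units.val_one, Int.cast_neg, Int.cast_one, neg_mul, one_mul] at h
  rw [bMinor, bMinor, ← h]
  congr 1
  ext c x
  simp only [Matrix.submatrix_apply, Matrix.of_apply, id]
  congr 3
  rw [Equiv.swap_apply_def, Equiv.swap_apply_def]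
  have e1 : (x.rev : ℕ) = i ↔ x = a := by
    rw [ha, ← Fin.rev_eq_iff, Fin.ext_iff]
  have e2 : (x.rev : ℕ) = i + 1 ↔ x = b := by
    rw [hb, ← Fin.rev_eq_iff, Fin.ext_iff]
  simp only [e1, e2]
  split_ifs <;> simp [ha, hb]

-- Chains live in an infinite function type, so the finite set is delivered with its
-- characterization. Its finiteness comes from the finitely many exponent matrices with prescribed
-- row sums.
open Classical in
theorem exists_lrChains (g : ℤ → ℂ) {M N k : ℕ} (s : Fin k ↪o Fin M) (r : Fin k ↪o Fin N) :
    ∃ T : Finset (ℕ → ℕ → ℤ),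
      (∀ Y, Y ∈ T ↔ (IsChain k (revTuple fun i => ((s i : ℕ) : ℤ)) Y ∧
        HasContent (fun j => ((r j.rev : ℕ) : ℤ) + 1) 1 Y) ∧ IsStripChain k Y ∧
          IsLatticeChain k Y) ∧
      minor (hankel g 1 M N) s r = ∑ Y ∈ T, bMinor g fun i : Fin k => Y k (i.rev : ℕ) := by
  set y := revTuple fun i => ((s i : ℕ) : ℤ) with hy
  set R : Fin k → ℤ := fun j => ((r j.rev : ℕ) : ℤ) + 1 with hR
  set S : Finset (Equiv.Perm (Fin k) × (ℕ → ℕ → ℤ)) :=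
    (univ.sigma fun π : Equiv.Perm (Fin k) => Fintype.piFinset fun j : Fin k =>
      comps k (R (π j) - ((j.rev : ℕ) : ℤ))).image fun x => (x.1, chainOf y x.2) with hS
  have memS : ∀ x, x ∈ S ↔ IsChain k y x.2 ∧ HasContent R x.1 x.2 := by
    rintro ⟨π, Y⟩
    simp only [hS, mem_image, mem_sigma, mem_univ, true_and, Fintype.mem_piFinset, mem_comps,
      Prod.mk.injEq, Sigma.exists]
    constructor
    · rintro ⟨π', a, ha, rfl, rfl⟩
      exact ⟨isChain_chainOf a, fun j => (content_chainOf a j).trans (ha j)⟩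
    · rintro ⟨h1, h2⟩
      obtain ⟨a, rfl⟩ := h1.exists_eq_chainOf
      exact ⟨π, a, fun j => (content_chainOf a j).symm.trans (h2 j), rfl, rfl⟩
  set T : Finset (ℕ → ℕ → ℤ) := ((S.filter fun x => x.1 = 1).image Prod.snd).filter
    fun Y => IsStripChain k Y ∧ IsLatticeChain k Y with hT
  have memT : ∀ Y, Y ∈ T ↔ (IsChain k y Y ∧ HasContent R 1 Y) ∧ IsStripChain k Y ∧
      IsLatticeChain k Y := by
    intro Y
    simp only [hT, mem_filter, mem_image, memS, Prod.exists, exists_eq_right]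
  refine ⟨T, memT, ?_⟩
  have hystrict : ∀ i, i + 1 < k → y (i + 1) < y i := by
    intro i hi
    rw [hy, revTuple, revTuple, dif_pos hi, dif_pos (by omega)]
    have : s (Fin.rev ⟨i + 1, hi⟩) < s (Fin.rev ⟨i, by omega⟩) :=
      s.strictMono (Fin.rev_lt_rev.2 (Fin.mk_lt_mk.2 (Nat.lt_succ_self i)))
    exact_mod_cast this
  have hRstrict : StrictAnti R := by
    intro i j hij
    have : r j.rev < r i.rev := r.strictMono (Fin.rev_lt_rev.2 hij)
    have : (r j.rev : ℕ) < r i.rev := this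
    simp only [hR]
    omega
  rw [← sum_signed_chains hystrict hRstrict
    (fun z => bMinor g fun i : Fin k => z (i.rev : ℕ)) (fun z i hi => bMinor_comp_swap g z hi)
    S memS T memT, minor_hankel_eq_sum, hS, sum_image, sum_sigma]
  · refine sum_congr rfl fun π _ => ?_
    rw [mul_sum]
    refine sum_congr rfl fun a _ => ?_
    congr 2
    funext i
    dsimp only
    rw [chainOf_last, hy, revTuple_val, Fin.rev_rev]
  · rintro ⟨π, a⟩ _ ⟨π', a'⟩ _ h
    simp only [Prod.mk.injEq] at h
    obtain ⟨rfl, h⟩ := h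
    rw [chainOf_injective h]

end HankelMinor

/-! ### Lattice chains and Littlewood–Richardson tableaux. -/

namespace HankelMinor

open Finset

section Tableau

variable {k : ℕ} {lam mu gam : Fin k → ℤ}

theorem mem_skewCells {c : Fin k × ℤ} : c ∈ skewCells gam lam ↔ lam c.1 < c.2 ∧ c.2 ≤ gam c.1 := by
  obtain ⟨i, x⟩ := c
  simp only [skewCells, mem_biUnion, mem_univ, true_and, mem_image, mem_Ioc, Prod.mk.injEq]
  constructor
  · rintro ⟨i', x', h, rfl, rfl⟩
    exact h
  · exact fun h => ⟨i, x, h, rfl, rfl⟩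

theorem IsChain.le {y : ℕ → ℤ} {Y : ℕ → ℕ → ℤ} (hY : IsChain k y Y) {i j j' : ℕ} (hi : i < k)
    (h : j ≤ j') (hj : j' ≤ k) : Y j i ≤ Y j' i := by
  induction j', h using Nat.le_induction with
  | base => exact le_rfl
  | succ j' h ih => exact (ih (by omega)).trans (hY.mono j' (by omega) i hi)

/-- A chain from the shape `lam` to the shape `gam`, both shifted by the staircase. -/
structure IsShapeChain (lam gam : Fin k → ℤ) (Y : ℕ → ℕ → ℤ) : Prop where
  chain : IsChain k (revTuple fun i => lam i.rev + ((i : ℕ) : ℤ)) Y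
  last : ∀ i : Fin k, Y k i = gam i + ((i.rev : ℕ) : ℤ)

/-- The `j`-th level of the chain `Y` is the shape of the entries of `T` less than `j`. -/
def Matches (T : skewCells gam lam → Fin k) (Y : ℕ → ℕ → ℤ) : Prop :=
  ∀ c : skewCells gam lam, ∀ j ≤ k,
    (T c : ℕ) < j ↔ c.1.2 + ((c.1.1.rev : ℕ) : ℤ) ≤ Y j (c.1.1 : ℕ)

theorem IsShapeChain.first {Y : ℕ → ℕ → ℤ} (h : IsShapeChain lam gam Y) (i : Fin k) :
    Y 0 i = lam i + ((i.rev : ℕ) : ℤ) := by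
  rw [h.chain.start i i.2, revTuple_val, Fin.rev_rev]

theorem IsShapeChain.lower {Y : ℕ → ℕ → ℤ} (h : IsShapeChain lam gam Y) (i : Fin k) {j : ℕ}
    (hj : j ≤ k) : lam i + ((i.rev : ℕ) : ℤ) ≤ Y j i :=
  h.first i ▸ h.chain.le i.2 (Nat.zero_le j) hj

theorem IsShapeChain.upper {Y : ℕ → ℕ → ℤ} (h : IsShapeChain lam gam Y) (i : Fin k) {j : ℕ}
    (hj : j ≤ k) : Y j i ≤ gam i + ((i.rev : ℕ) : ℤ) :=
  h.last i ▸ h.chain.le i.2 hj le_rfl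

theorem IsShapeChain.shape_le {Y : ℕ → ℕ → ℤ} (h : IsShapeChain lam gam Y) : lam ≤ gam := by
  intro i
  have h1 := h.lower i le_rfl
  rw [h.last i] at h1
  exact le_of_add_le_add_right h1

/-- The number of entries less than `j` in row `i`. -/
noncomputable def rowCount (T : skewCells gam lam → Fin k) (j : ℕ) (i : Fin k) : ℕ :=
  (univ.filter fun c => c.1.1 = i ∧ (T c : ℕ) < j).card

theorem rowCount_eq_card (T : skewCells gam lam → Fin k) (j : ℕ) (i : Fin k) :
    rowCount T j i =
      ((univ.filter fun c => c.1.1 = i ∧ (T c : ℕ) < j).image fun c => c.1.2).card := by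
  rw [card_image_of_injOn, rowCount]
  intro c hc d hd h
  simp only [coe_filter, mem_univ, true_and, Set.mem_ofPred_eq] at hc hd
  exact Subtype.ext (Prod.ext (hc.1.trans hd.1.symm) h)

theorem rowCount_eq {T : skewCells gam lam → Fin k} {j : ℕ} {i : Fin k} {x : ℤ} (h0 : lam i ≤ x)
    (h1 : x ≤ gam i) (h : ∀ c : skewCells gam lam, c.1.1 = i → ((T c : ℕ) < j ↔ c.1.2 ≤ x)) :
    (rowCount T j i : ℤ) = x - lam i := by
  have : ((univ.filter fun c => c.1.1 = i ∧ (T c : ℕ) < j).image fun c => c.1.2) =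
      Ioc (lam i) x := by
    ext z
    simp only [mem_image, mem_filter, mem_univ, true_and, mem_Ioc]
    constructor
    · rintro ⟨c, ⟨rfl, hc⟩, rfl⟩
      exact ⟨(mem_skewCells.1 c.2).1, (h c rfl).1 hc⟩
    · rintro ⟨ha, hb⟩
      have hm : (i, z) ∈ skewCells gam lam := mem_skewCells.2 ⟨ha, hb.trans h1⟩
      exact ⟨⟨(i, z), hm⟩, ⟨rfl, (h ⟨(i, z), hm⟩ rfl).2 hb⟩, rfl⟩
  rw [rowCount_eq_card, this, Int.card_Ioc]
  omega

theorem Matches.rowCount {T : skewCells gam lam → Fin k} {Y : ℕ → ℕ → ℤ} (hT : Matches T Y)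
    (hY : IsShapeChain lam gam Y) {j : ℕ} (hj : j ≤ k) (i : Fin k) :
    Y j i = lam i + ((i.rev : ℕ) : ℤ) + rowCount T j i := by
  have h1 := hY.lower i hj
  have h2 := hY.upper i hj
  rw [rowCount_eq (x := Y j i - ((i.rev : ℕ) : ℤ)) (by omega) (by omega)]
  · ring
  · rintro c rfl
    rw [hT c j hj]
    omega

/-- The chain of shapes of a tableau. -/
noncomputable def chainOfTableau (T : skewCells gam lam → Fin k) (j i : ℕ) : ℤ :=
  if h : j ≤ k ∧ i < k then lam ⟨i, h.2⟩ + ((Fin.rev ⟨i, h.2⟩ : ℕ) : ℤ) + rowCount T j ⟨i, h.2⟩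
  else 0

theorem chainOfTableau_val (T : skewCells gam lam → Fin k) {j : ℕ} (hj : j ≤ k) (i : Fin k) :
    chainOfTableau T j i = lam i + ((i.rev : ℕ) : ℤ) + rowCount T j i := by
  rw [chainOfTableau, dif_pos ⟨hj, i.2⟩]

theorem Matches.eq_chainOfTableau {T : skewCells gam lam → Fin k} {Y : ℕ → ℕ → ℤ}
    (hT : Matches T Y) (hY : IsShapeChain lam gam Y) : Y = chainOfTableau T := by
  funext j i
  by_cases h : j ≤ k ∧ i < k
  · rw [chainOfTableau, dif_pos h]
    exact hT.rowCount hY h.1 ⟨i, h.2⟩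
  · rw [chainOfTableau, dif_neg h, hY.chain.outside j i (by omega)]

theorem isShapeChain_chainOfTableau (hle : lam ≤ gam) (T : skewCells gam lam → Fin k) :
    IsShapeChain lam gam (chainOfTableau T) := by
  refine ⟨⟨fun i hi => ?_, fun j hj i hi => ?_, fun j i h => ?_⟩, fun i => ?_⟩
  · have := chainOfTableau_val T (Nat.zero_le k) ⟨i, hi⟩
    dsimp only at this
    rw [this, revTuple, dif_pos hi, Fin.rev_rev]
    simp [HankelMinor.rowCount]
  · have h1 := chainOfTableau_val T hj.le ⟨i, hi⟩
    have h2 := chainOfTableau_val T (j := j + 1) hj ⟨i, hi⟩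
    dsimp only at h1 h2
    have h3 : HankelMinor.rowCount T j ⟨i, hi⟩ ≤ HankelMinor.rowCount T (j + 1) ⟨i, hi⟩ := by
      refine card_le_card fun c hc => ?_
      simp only [mem_filter, mem_univ, true_and] at hc ⊢
      exact ⟨hc.1, by omega⟩
    omega
  · rw [chainOfTableau, dif_neg (by omega)]
  · rw [chainOfTableau_val T le_rfl, rowCount_eq (x := gam i) (hle i) le_rfl]
    · ring
    · rintro c rfl
      simp [(mem_skewCells.1 c.2).2]

theorem matches_chainOfTableau {T : skewCells gam lam → Fin k}
    (hrow : ∀ c d : skewCells gam lam, c.1.1 = d.1.1 → c.1.2 < d.1.2 → T c ≤ T d) :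
    Matches T (chainOfTableau T) := by
  intro c j hj
  rw [chainOfTableau_val T hj, rowCount_eq_card]
  have hc := mem_skewCells.1 c.2
  constructor
  · intro h
    have hsub : Ioc (lam c.1.1) c.1.2 ⊆
        ((univ.filter fun d => d.1.1 = c.1.1 ∧ (T d : ℕ) < j).image fun d => d.1.2) := by
      intro z hz
      rw [mem_Ioc] at hz
      have hm : (c.1.1, z) ∈ skewCells gam lam := mem_skewCells.2 ⟨hz.1, hz.2.trans hc.2⟩
      simp only [mem_image, mem_filter, mem_univ, true_and]
      refine ⟨⟨_, hm⟩, ⟨rfl, ?_⟩, rfl⟩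
      rcases hz.2.lt_or_eq with h' | h'
      · exact lt_of_le_of_lt (hrow ⟨_, hm⟩ c rfl h') h
      · subst h'
        exact h
    have := card_le_card hsub
    rw [Int.card_Ioc] at this
    omega
  · intro h
    by_contra hn
    have hsub : ((univ.filter fun d => d.1.1 = c.1.1 ∧ (T d : ℕ) < j).image fun d => d.1.2) ⊆
        Ioc (lam c.1.1) (c.1.2 - 1) := by
      intro z hz
      simp only [mem_image, mem_filter, mem_univ, true_and] at hz
      obtain ⟨d, ⟨hd, hTd⟩, rfl⟩ := hz
      have hd' := mem_skewCells.1 d.2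
      rw [hd] at hd'
      rw [mem_Ioc]
      refine ⟨hd'.1, ?_⟩
      by_contra hlt
      rcases (show c.1.2 ≤ d.1.2 by omega).lt_or_eq with h' | h'
      · have : (T c : ℕ) ≤ T d := hrow c d hd.symm h'
        omega
      · have : c = d := Subtype.ext (Prod.ext hd.symm h')
        exact hn (this ▸ hTd)
    have := card_le_card hsub
    rw [Int.card_Ioc] at this
    omega

theorem Matches.unique {T T' : skewCells gam lam → Fin k} {Y : ℕ → ℕ → ℤ} (h : Matches T Y)
    (h' : Matches T' Y) : T = T' := by
  funext c
  have key : ∀ j ≤ k, (T c : ℕ) < j ↔ (T' c : ℕ) < j := fun j hj => (h c j hj).trans (h' c j hj).symm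
  have h1 := key (T c + 1) (T c).2
  have h2 := key (T' c + 1) (T' c).2
  exact Fin.ext (by omega)

theorem IsShapeChain.exists_matches {Y : ℕ → ℕ → ℤ} (hY : IsShapeChain lam gam Y) :
    ∃ T : skewCells gam lam → Fin k, Matches T Y := by
  have key : ∀ c : skewCells gam lam, ∃ t : Fin k, ∀ j ≤ k,
      (t : ℕ) < j ↔ c.1.2 + ((c.1.1.rev : ℕ) : ℤ) ≤ Y j (c.1.1 : ℕ) := by
    intro c
    have hc := mem_skewCells.1 c.2
    have hl := hY.last c.1.1
    have hf := hY.first c.1.1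
    -- `m` is the first level whose shape contains the box. The box lies outside `lam`, so `m` is
    -- positive and the entry is `m - 1`.
    obtain ⟨m, hm, hmin⟩ := exists_first
      (p := fun j => j ≤ k ∧ c.1.2 + ((c.1.1.rev : ℕ) : ℤ) ≤ Y j (c.1.1 : ℕ))
      ⟨k, le_rfl, by omega⟩
    have hm0 : m ≠ 0 := by
      rintro rfl
      omega
    refine ⟨⟨m - 1, by omega⟩, fun j hj => ⟨fun h => ?_, fun h => ?_⟩⟩
    · dsimp only at h
      exact hm.2.trans (hY.chain.le c.1.1.2 (by omega) hj)
    · by_contra hn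
      dsimp only at hn
      exact hmin j (by omega) ⟨hj, h⟩
  choose T hT using key
  exact ⟨T, hT⟩

section Conditions

variable {T : skewCells gam lam → Fin k} {Y : ℕ → ℕ → ℤ}

theorem Matches.row_weak (hT : Matches T Y) (c d : skewCells gam lam) (h : c.1.1 = d.1.1)
    (h' : c.1.2 < d.1.2) : T c ≤ T d := by
  have h1 := (hT d (T d + 1) (T d).2).1 (Nat.lt_succ_self _)
  have h2 := hT c (T d + 1) (T d).2
  rw [← h] at h1
  have : (T c : ℕ) < T d + 1 := h2.2 (by omega)
  exact Fin.le_def.2 (by omega)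

theorem Matches.letterCount (hT : Matches T Y) (hY : IsShapeChain lam gam Y) (a i : Fin k) :
    ((univ.filter fun c => c.1.1 = i ∧ T c = a).card : ℤ) = Y (a + 1) i - Y a i := by
  rw [hT.rowCount hY a.2, hT.rowCount hY a.2.le]
  have : HankelMinor.rowCount T (a + 1) i =
      HankelMinor.rowCount T a i + (univ.filter fun c => c.1.1 = i ∧ T c = a).card := by
    rw [HankelMinor.rowCount, HankelMinor.rowCount, ← card_union_of_disjoint]
    · congr 1
      ext c
      simp only [mem_filter, mem_univ, true_and, mem_union, Fin.ext_iff]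
      omega
    · rw [disjoint_filter]
      rintro c _ ⟨_, h⟩ ⟨_, h'⟩
      rw [h'] at h
      exact lt_irrefl _ h
  rw [this]
  push_cast
  ring

theorem Matches.rowsCount (hT : Matches T Y) (hY : IsShapeChain lam gam Y) (a : Fin k) {r : ℕ}
    (hr : r ≤ k) : ((univ.filter fun c => (c.1.1 : ℕ) < r ∧ T c = a).card : ℤ) =
      ∑ i ∈ range r, (Y (a + 1) i - Y a i) := by
  induction r with
  | zero => simp
  | succ r ih =>
    have h1 := hT.letterCount hY a ⟨r, hr⟩
    dsimp only at h1
    rw [sum_range_succ, ← ih (by omega), ← h1, ← Nat.cast_add, ← card_union_of_disjoint]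
    · congr 2
      ext c
      simp only [mem_filter, mem_univ, true_and, mem_union, Fin.ext_iff]
      omega
    · rw [disjoint_filter]
      rintro c _ ⟨h, _⟩ ⟨h', _⟩
      rw [h'] at h
      exact lt_irrefl _ h

theorem Matches.weight (hT : Matches T Y) (hY : IsShapeChain lam gam Y) (a : Fin k) :
    ((univ.filter fun c => T c = a).card : ℤ) = content k Y a := by
  rw [content, ← sum_sub_distrib, ← hT.rowsCount hY a le_rfl]
  simp

theorem Matches.lattice_iff (hT : Matches T Y) (hY : IsShapeChain lam gam Y) {a b : Fin k}
    (hab : (b : ℕ) = a + 1) {r : ℕ} (hr : r < k) :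
    excess Y r a + (Y (a + 2) r - Y (a + 1) r) ≤ 0 ↔
      (univ.filter fun c => (c.1.1 : ℕ) < r + 1 ∧ T c = b).card ≤
        (univ.filter fun c => (c.1.1 : ℕ) < r ∧ T c = a).card := by
  have h1 := hT.rowsCount hY a hr.le
  have h2 := hT.rowsCount hY b (r := r + 1) hr
  rw [hab, sum_range_succ] at h2
  rw [excess, sum_sub_distrib, ← h1]
  have e1 : ∑ x ∈ range r, (Y (a + 1 + 1) x - Y (a + 1) x) =
    ∑ x ∈ range r, (Y (a + 2) x - Y (a + 1) x) := rfl
  have e2 : Y (a + 1 + 1) r = Y (a + 2) r := rfl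
  omega

theorem Matches.strip (hT : Matches T Y) (hY : IsShapeChain lam gam Y) (hlam : Antitone lam)
    (hgam : Antitone gam)
    (hcol : ∀ c d : skewCells gam lam, c.1.2 = d.1.2 → c.1.1 < d.1.1 → T c < T d) :
    IsStripChain k Y := by
  intro j hj i hi
  by_contra hn
  set i1 : Fin k := ⟨i + 1, hi⟩
  set i0 : Fin k := ⟨i, by omega⟩
  have hlt : i0 < i1 := Fin.mk_lt_mk.2 (Nat.lt_succ_self i)
  have hr : (i0.rev : ℕ) = i1.rev + 1 := by
    simp only [Fin.val_rev, i0, i1]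
    omega
  have u := hY.upper i1 (j := j + 1) hj
  have l := hY.lower i0 hj.le
  have a1 := hlam hlt.le
  have a2 := hgam hlt.le
  have hn' : Y j (i0 : ℕ) ≤ Y (j + 1) (i1 : ℕ) := not_lt.1 hn
  -- Column `x` is the last one of row `i + 1` on level `j + 1`. The box there has entry at most
  -- `j`, while failure of interlacing puts the box above it in the skew shape with entry at least
  -- `j`.
  set x := Y (j + 1) (i1 : ℕ) - ((i1.rev : ℕ) : ℤ) with hx
  have m1 : (i1, x) ∈ skewCells gam lam := mem_skewCells.2 ⟨by dsimp only; omega, by dsimp only; omega⟩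
  have m0 : (i0, x) ∈ skewCells gam lam := mem_skewCells.2 ⟨by dsimp only; omega, by dsimp only; omega⟩
  have h := hcol ⟨_, m0⟩ ⟨_, m1⟩ rfl hlt
  have h1 := (hT ⟨_, m1⟩ (j + 1) hj).2 (by dsimp only; omega)
  have h0 := (hT ⟨_, m0⟩ j hj.le).not.2 (by dsimp only; omega)
  have h' : (T ⟨_, m0⟩ : ℕ) < T ⟨_, m1⟩ := h
  omega

theorem Matches.col_strict (hT : Matches T Y) (hY : IsShapeChain lam gam Y)
    (hs : IsStripChain k Y) (c d : skewCells gam lam) (h : c.1.2 = d.1.2) (h' : c.1.1 < d.1.1) :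
    T c < T d := by
  have hd := (hT d (T d + 1) (T d).2).1 (Nat.lt_succ_self _)
  refine (hT c (T d) (T d).2.le).2 ?_
  -- Iterated interlacing: the gain `m + 1` is the staircase difference between the two rows.
  have key : ∀ m i : ℕ, i + 1 + m < k →
      Y (T d + 1) (i + 1 + m) + (m + 1) ≤ Y (T d) i := by
    intro m
    induction m with
    | zero =>
      intro i hi
      have := hs (T d) (T d).2 i hi
      simp only [add_zero, Nat.cast_zero] at *
      omega
    | succ m ih =>
      intro i hi
      have h1 := ih (i + 1) (by omega)
      have h2 := hs (T d) (T d).2 i (by omega)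
      have h3 := hY.chain.mono (T d) (T d).2 (i + 1) (by omega)
      rw [show i + 1 + 1 + m = i + 1 + (m + 1) by ring] at h1
      push_cast
      omega
  have hlt : (c.1.1 : ℕ) < d.1.1 := h'
  have h1 := key (d.1.1 - c.1.1 - 1) c.1.1 (by omega)
  rw [show (c.1.1 : ℕ) + 1 + (d.1.1 - c.1.1 - 1) = d.1.1 by omega] at h1
  have h2 := d.1.1.2
  simp only [Fin.val_rev] at hd ⊢
  omega

theorem Matches.isLRTableau (hT : Matches T Y) (hY : IsShapeChain lam gam Y)
    (hs : IsStripChain k Y) (hl : IsLatticeChain k Y) (hw : ∀ a : Fin k, content k Y a = mu a) :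
    IsLRTableau lam mu gam T := by
  classical
  refine ⟨hT.row_weak, hT.col_strict hY hs, fun a => ?_, fun c a b hab => ?_⟩
  · rw [← hw a, ← hT.weight hY a]
  · have h := (hT.lattice_iff hY hab c.1.1.2).1 (hl c.1.1 c.1.1.2 a (hab ▸ b.2))
    refine le_trans (card_le_card ?_) (h.trans (card_le_card ?_))
    · intro d hd
      simp only [mem_filter, mem_univ, true_and] at hd ⊢
      refine ⟨?_, hd.2⟩
      rcases hd.1 with h1 | h1
      · exact Nat.lt_succ_of_lt h1
      · rw [h1.1]
        exact Nat.lt_succ_self _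
    · intro d hd
      simp only [mem_filter, mem_univ, true_and] at hd ⊢
      exact ⟨Or.inl hd.1, hd.2⟩

/-- If row `r` contains `b`, the decisive prefix ends at its leftmost `b`: all letters `b` of the
row have been read, but no `a`, as rows increase. If it contains no `b`, the bound is inherited from
the row above. -/
theorem Matches.isLatticeChain (hT : Matches T Y) (hY : IsShapeChain lam gam Y)
    (hlat : IsLRTableau lam mu gam T) : IsLatticeChain k Y := by
  classical
  intro r hr j hj
  set a : Fin k := ⟨j, by omega⟩
  set b : Fin k := ⟨j + 1, hj⟩
  have hab : (b : ℕ) = a + 1 := rfl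
  refine (hT.lattice_iff hY hab hr).2 ?_
  have step : ∀ r, (∃ c : skewCells gam lam, (c.1.1 : ℕ) = r ∧ T c = b) →
      (univ.filter fun c => (c.1.1 : ℕ) < r + 1 ∧ T c = b).card ≤
        (univ.filter fun c => (c.1.1 : ℕ) < r ∧ T c = a).card := by
    rintro r ⟨c0, hc0⟩
    obtain ⟨c, hc, hmin⟩ := exists_min_image
      (univ.filter fun c : skewCells gam lam => (c.1.1 : ℕ) = r ∧ T c = b) (fun c => c.1.2)
      ⟨c0, by simpa using hc0⟩
    simp only [mem_filter, mem_univ, true_and] at hc hmin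
    refine le_trans (card_le_card ?_) ((hlat.lattice c a b hab).trans (card_le_card ?_))
    · intro d hd
      simp only [mem_filter, mem_univ, true_and] at hd ⊢
      refine ⟨?_, hd.2⟩
      rcases (Nat.lt_succ_iff.1 hd.1).lt_or_eq with h | h
      · exact Or.inl (Fin.lt_def.2 (by omega))
      · exact Or.inr ⟨Fin.ext (by omega), hmin d ⟨h, hd.2⟩⟩
    · intro d hd
      simp only [mem_filter, mem_univ, true_and] at hd ⊢
      refine ⟨?_, hd.2⟩
      rcases hd.1 with h | ⟨h, h'⟩
      · rw [← hc.1]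
        exact h
      · have hle : T c ≤ T d := by
          rcases h'.lt_or_eq with h2 | h2
          · exact hT.row_weak c d h.symm h2
          · rw [Subtype.ext (Prod.ext h.symm h2) (a1 := c) (a2 := d)]
        rw [hc.2, hd.2, Fin.le_def] at hle
        omega
  have skip : ∀ r, (¬∃ c : skewCells gam lam, (c.1.1 : ℕ) = r ∧ T c = b) →
      (univ.filter fun c => (c.1.1 : ℕ) < r + 1 ∧ T c = b) ⊆
        (univ.filter fun c => (c.1.1 : ℕ) < r ∧ T c = b) := by
    intro r hr d hd
    simp only [mem_filter, mem_univ, true_and] at hd ⊢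
    refine ⟨lt_of_le_of_ne (Nat.lt_succ_iff.1 hd.1) fun h => hr ⟨d, h, hd.2⟩, hd.2⟩
  suffices main : ∀ r, (univ.filter fun c => (c.1.1 : ℕ) < r + 1 ∧ T c = b).card ≤
      (univ.filter fun c => (c.1.1 : ℕ) < r ∧ T c = a).card from main r
  intro r
  induction r with
  | zero =>
    by_cases hex : ∃ c : skewCells gam lam, (c.1.1 : ℕ) = 0 ∧ T c = b
    · exact step 0 hex
    · simpa using card_le_card (skip 0 hex)
  | succ r ih =>
    by_cases hex : ∃ c : skewCells gam lam, (c.1.1 : ℕ) = r + 1 ∧ T c = b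
    · exact step _ hex
    · refine (card_le_card (skip _ hex)).trans (ih.trans (card_le_card ?_))
      intro d hd
      simp only [mem_filter, mem_univ, true_and] at hd ⊢
      exact ⟨by omega, hd.2⟩

end Conditions

/-- Littlewood–Richardson coefficients count lattice chains. -/
theorem lrCoeff_eq_card (hlam : Antitone lam) (hgam : Antitone gam) (S : Finset (ℕ → ℕ → ℤ))
    (hS : ∀ Y, Y ∈ S ↔ IsShapeChain lam gam Y ∧ (∀ a : Fin k, content k Y a = mu a) ∧
      IsStripChain k Y ∧ IsLatticeChain k Y) : lrCoeff lam mu gam = S.card := by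
  classical
  rw [lrCoeff, ← Nat.card_eq_finsetCard]
  have fwd : ∀ T : skewCells gam lam → Fin k, lam ≤ gam ∧ IsLRTableau lam mu gam T →
      chainOfTableau T ∈ S := by
    rintro T ⟨hle, hT⟩
    have hY := isShapeChain_chainOfTableau hle T
    have hm := matches_chainOfTableau hT.row_weak
    refine (hS _).2 ⟨hY, fun a => ?_, hm.strip hY hlam hgam hT.col_strict,
      hm.isLatticeChain hY hT⟩
    rw [← hm.weight hY a, ← hT.weight a]
  refine Nat.card_congr (Equiv.ofBijective (fun T => ⟨chainOfTableau T.1, fwd T.1 T.2⟩) ⟨?_, ?_⟩)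
  · rintro ⟨T, hT⟩ ⟨T', hT'⟩ h
    have h1 := matches_chainOfTableau hT.2.row_weak
    rw [Subtype.mk.injEq] at h
    rw [h] at h1
    exact Subtype.ext (h1.unique (matches_chainOfTableau hT'.2.row_weak))
  · rintro ⟨Y, hYS⟩
    obtain ⟨hY, hw, hs, hl⟩ := (hS Y).1 hYS
    obtain ⟨T, hT⟩ := hY.exists_matches
    exact ⟨⟨T, hY.shape_le, hT.isLRTableau hY hs hl hw⟩,
      Subtype.ext (hT.eq_chainOfTableau hY).symm⟩

end Tableau

end HankelMinor

/-! ### Bounds on the last row, and the diagonal chain. -/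

namespace HankelMinor

open Finset

section Bounds

variable {k : ℕ} {y : ℕ → ℤ} {Y : ℕ → ℕ → ℤ}

/-- By induction no letter `j` stands above row `j`: letters `j + 1` in rows up to `r` are bounded
by letters `j` in rows before `r`. -/
theorem IsLatticeChain.sum_letter_nonpos (hl : IsLatticeChain k Y) {j : ℕ} (hj : j < k) {r : ℕ}
    (hr : r ≤ j) : ∑ i ∈ range r, (Y (j + 1) i - Y j i) ≤ 0 := by
  induction j generalizing r with
  | zero =>
    obtain rfl : r = 0 := by omega
    simp
  | succ j ih =>
    cases r with
    | zero => simp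
    | succ r =>
      have h1 := hl r (by omega) j hj
      have h2 := ih (by omega) (r := r) (by omega)
      rw [excess, sum_sub_distrib] at h1
      rw [sum_range_succ]
      have e1 : ∑ x ∈ range r, (Y (j + 1 + 1) x - Y (j + 1) x) =
        ∑ x ∈ range r, (Y (j + 2) x - Y (j + 1) x) := rfl
      have e2 : Y (j + 1 + 1) r = Y (j + 2) r := rfl
      omega

theorem IsChain.letter_eq (hY : IsChain k y Y) (hl : IsLatticeChain k Y) {i j : ℕ} (hj : j < k)
    (hi : i < j) : Y (j + 1) i = Y j i := by
  have h := hl.sum_letter_nonpos hj (r := i + 1) hi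
  have h1 := single_le_sum (f := fun i => Y (j + 1) i - Y j i) (s := range (i + 1))
    (fun x hx => sub_nonneg.2 (hY.mono j hj x (by rw [mem_range] at hx; omega)))
    (mem_range.2 (Nat.lt_succ_self i))
  have h2 := hY.mono j hj i (by omega)
  omega

/-- Equal letters occupy distinct columns: by interlacing, those below row `i` are already counted
by the entry of row `i` before its own letters `j` are added. The term `m` is the staircase. -/
theorem IsChain.sum_Ico_letter_le (hY : IsChain k y Y) (hs : IsStripChain k Y)
    (hy : ∀ i < k, 0 ≤ y i) {j : ℕ} (hj : j < k) (m i : ℕ) (hi : i + m + 1 = k) :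
    ∑ x ∈ Ico i k, (Y (j + 1) x - Y j x) + m ≤ Y (j + 1) i := by
  induction m generalizing i with
  | zero =>
    obtain rfl : k = i + 1 := by omega
    rw [Nat.Ico_succ_singleton, sum_singleton]
    have h1 := hY.le (i := i) (by omega) (Nat.zero_le j) hj.le
    rw [hY.start i (by omega)] at h1
    have := hy i (by omega)
    simp only [Nat.cast_zero]
    omega
  | succ m ih =>
    have h1 := ih (i + 1) (by omega)
    have h2 := hs j hj i (by omega)
    rw [sum_eq_sum_Ico_succ_bot (by omega)]
    push_cast
    omega

theorem IsChain.content_add_le_last (hY : IsChain k y Y) (hs : IsStripChain k Y)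
    (hl : IsLatticeChain k Y) (hy : ∀ i < k, 0 ≤ y i) (j : Fin k) :
    content k Y j + ((j.rev : ℕ) : ℤ) ≤ Y k j := by
  have h1 := hY.sum_Ico_letter_le hs hy j.2 j.rev j (by rw [Fin.val_rev]; omega)
  have h2 := hl.sum_letter_nonpos j.2 le_rfl
  have h3 := hY.le j.2 (j := j + 1) j.2 le_rfl
  rw [content, ← sum_sub_distrib, range_eq_Ico, ← sum_Ico_consecutive _ (Nat.zero_le (j : ℕ)) j.2.le,
    ← range_eq_Ico]
  omega

/-- The top row receives only letters 0. -/
theorem IsChain.last_zero_le (hY : IsChain k y Y) (hl : IsLatticeChain k Y) (hk : 0 < k) :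
    Y k 0 ≤ y 0 + content k Y 0 := by
  have h : ∀ j, j + 1 ≤ k → Y (j + 1) 0 = Y 1 0 := by
    intro j
    induction j with
    | zero => exact fun _ => rfl
    | succ j ih =>
      intro hj
      rw [hY.letter_eq hl (j := j + 1) hj (Nat.succ_pos j), ih (by omega)]
  have h1 := h (k - 1) (by omega)
  rw [Nat.sub_add_cancel hk] at h1
  have h2 := single_le_sum (f := fun i => Y 1 i - Y 0 i) (s := range k)
    (fun x hx => sub_nonneg.2 (hY.mono 0 hk x (mem_range.1 hx))) (mem_range.2 hk)
  have h3 := hY.start 0 hk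
  rw [content, ← sum_sub_distrib]
  simp only [zero_add]
  omega

theorem IsChain.sum_last (hY : IsChain k y Y) :
    ∑ i ∈ range k, Y k i = ∑ i ∈ range k, y i + ∑ j ∈ range k, content k Y j := by
  have h := sum_range_sub (fun j => ∑ i ∈ range k, Y j i) k
  have h0 : ∑ i ∈ range k, Y 0 i = ∑ i ∈ range k, y i :=
    sum_congr rfl fun i hi => hY.start i (mem_range.1 hi)
  rw [h0] at h
  simp only [content]
  omega

/-- The chain whose letters `j` all lie in row `j`. -/
def diagonalChain (k : ℕ) (y e : ℕ → ℤ) (j i : ℕ) : ℤ :=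
  if j ≤ k ∧ i < k then y i + (if i < j then e i else 0) else 0

variable {e : ℕ → ℤ}

theorem diagonalChain_letter {i j : ℕ} (hj : j < k) (hi : i < k) :
    diagonalChain k y e (j + 1) i - diagonalChain k y e j i = if i = j then e j else 0 := by
  rw [diagonalChain, diagonalChain, if_pos (show j + 1 ≤ k ∧ i < k from ⟨hj, hi⟩),
    if_pos (show j ≤ k ∧ i < k from ⟨hj.le, hi⟩)]
  rcases lt_trichotomy i j with h | h | h
  · rw [if_pos (by omega), if_pos h, if_neg (by omega)]
    ring
  · subst h
    simp
  · rw [if_neg (by omega), if_neg (by omega), if_neg (by omega)]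
    ring

theorem isChain_diagonalChain (he : ∀ i < k, 0 ≤ e i) : IsChain k y (diagonalChain k y e) := by
  refine ⟨fun i hi => by simp [diagonalChain, hi], fun j hj i hi => ?_, fun j i h => ?_⟩
  · have h := diagonalChain_letter (y := y) (e := e) hj hi
    have := he j hj
    split_ifs at h <;> omega
  · rw [diagonalChain, if_neg (by omega)]

theorem content_diagonalChain {j : ℕ} (hj : j < k) : content k (diagonalChain k y e) j = e j := by
  rw [content, ← sum_sub_distrib,
    sum_congr rfl fun i hi => diagonalChain_letter hj (mem_range.1 hi)]
  simp [hj]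

theorem isStripChain_diagonalChain (hy : ∀ i, i + 1 < k → y (i + 1) < y i)
    (he : ∀ i, i + 1 < k → e (i + 1) ≤ e i) : IsStripChain k (diagonalChain k y e) := by
  intro j hj i hi
  have := hy i hi
  have := he i hi
  rw [diagonalChain, diagonalChain, if_pos (show j + 1 ≤ k ∧ i + 1 < k from ⟨hj, hi⟩),
    if_pos (show j ≤ k ∧ i < k by omega)]
  split_ifs <;> omega

theorem isLatticeChain_diagonalChain (h0 : ∀ i < k, 0 ≤ e i)
    (he : ∀ i, i + 1 < k → e (i + 1) ≤ e i) : IsLatticeChain k (diagonalChain k y e) := by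
  intro r hr j hj
  have h : ∀ i ∈ range r, diagonalChain k y e (j + 2) i - diagonalChain k y e (j + 1) i -
      (diagonalChain k y e (j + 1) i - diagonalChain k y e j i) =
      (if i = j + 1 then e (j + 1) else 0) - if i = j then e j else 0 := by
    intro i hi
    have hi := mem_range.1 hi
    rw [diagonalChain_letter (j := j + 1) hj (hi.trans hr),
      diagonalChain_letter (j := j) (by omega) (hi.trans hr)]
  rw [excess, sum_congr rfl h, diagonalChain_letter (j := j + 1) hj hr, sum_sub_distrib]
  simp only [sum_ite_eq', mem_range]
  have := he j hj
  have := h0 j (by omega)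
  split_ifs <;> omega

end Bounds

/-- Take p = v - r and let μ be p sorted decreasingly; then p + r = v is already sorted. -/
theorem mem_vStar_of_le {k : ℕ} {lam r v : Fin k → ℤ} (hv : StrictMono v) (hr : r ≤ v)
    (hsum : ∑ i, v i = ∑ i, r i + ∑ i, lam i) : v ∈ vStar lam r := by
  rw [vStar, Set.Finite.mem_toFinset]
  set p : Fin k → ℤ := v - r with hp
  set τ : Equiv.Perm (Fin k) := Fin.revPerm.trans (Tuple.sort p) with hτ
  refine ⟨hv, p ∘ τ, ⟨fun i => ?_, ?_, ?_⟩, p, ⟨τ.symm, ?_⟩, ?_⟩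
  · exact sub_nonneg.2 (hr _)
  · intro i j hij
    exact Tuple.monotone_sort p (Fin.rev_le_rev.2 hij)
  · have h := Equiv.sum_comp τ p
    simp only [Function.comp_apply]
    rw [h, hp]
    simp only [Pi.sub_apply, sum_sub_distrib]
    omega
  · funext i
    simp
  · rw [hp, sub_add_cancel, sortUp, Tuple.sort_eq_refl_iff_monotone.2 hv.monotone]
    rfl

/-! ### The expansion of the minor. -/

section Main

variable {M N k : ℕ} (s : Fin k ↪o Fin M) (r : Fin k ↪o Fin N)

/-- The lattice chains whose number with a given last row is a Littlewood–Richardson coefficient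
in the expansion of the minor with rows `s` and columns `r`. -/
structure IsLRChain (Y : ℕ → ℕ → ℤ) : Prop where
  chain : IsChain k (revTuple fun i => ((s i : ℕ) : ℤ)) Y
  content : HasContent (fun j => ((r j.rev : ℕ) : ℤ) + 1) 1 Y
  strip : IsStripChain k Y
  lattice : IsLatticeChain k Y

theorem revTuple_lt {n : ℕ} (s : Fin k ↪o Fin n) {i : ℕ} (hi : i + 1 < k) :
    revTuple (fun i => ((s i : ℕ) : ℤ)) (i + 1) < revTuple (fun i => ((s i : ℕ) : ℤ)) i := by
  rw [revTuple, revTuple, dif_pos hi, dif_pos (by omega)]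
  have : s (Fin.rev ⟨i + 1, hi⟩) < s (Fin.rev ⟨i, by omega⟩) :=
    s.strictMono (Fin.rev_lt_rev.2 (Fin.mk_lt_mk.2 (Nat.lt_succ_self i)))
  exact_mod_cast this

theorem val_le_of_orderEmbedding {n : ℕ} (s : Fin k ↪o Fin n) (i : Fin k) : (i : ℕ) ≤ s i := by
  obtain ⟨i, hi⟩ := i
  induction i with
  | zero => exact Nat.zero_le _
  | succ i ih =>
    have h1 := ih (by omega)
    have h2 : s ⟨i, by omega⟩ < s ⟨i + 1, hi⟩ :=
      s.strictMono (Fin.mk_lt_mk.2 (Nat.lt_succ_self i))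
    rw [Fin.lt_def] at h2
    dsimp only at h1 ⊢
    omega

theorem revTuple_lamOf_eq :
    (revTuple fun i => lamOf (oneBased s) i.rev + ((i : ℕ) : ℤ)) =
      revTuple fun i => ((s i : ℕ) : ℤ) := by
  congr 1
  funext i
  simp only [lamOf, oneBased, Fin.rev_rev]
  ring

theorem antitone_lamOf : Antitone (lamOf (oneBased s)) := by
  cases k with
  | zero => exact fun i => i.elim0
  | succ n =>
    refine Fin.antitone_iff_succ_le.2 fun i => ?_
    have h : s i.succ.rev < s i.castSucc.rev :=
      s.strictMono (Fin.rev_lt_rev.2 Fin.castSucc_lt_succ)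
    rw [Fin.lt_def] at h
    simp only [lamOf, oneBased, Fin.val_rev, Fin.val_succ, Fin.val_castSucc]
    omega

theorem antitone_shapeOf {v : Fin k → ℤ} (hv : StrictMono v) : Antitone (shapeOf v) := by
  cases k with
  | zero => exact fun i => i.elim0
  | succ n =>
    refine Fin.antitone_iff_succ_le.2 fun i => ?_
    have h : v i.succ.rev < v i.castSucc.rev :=
      hv (Fin.rev_lt_rev.2 Fin.castSucc_lt_succ)
    simp only [shapeOf, Fin.val_succ, Fin.val_castSucc]
    push_cast
    omega

theorem lrCoeff_eq_card_filter (T : Finset (ℕ → ℕ → ℤ)) (hT : ∀ Y, Y ∈ T ↔ IsLRChain s r Y)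
    {v : Fin k → ℤ} (hv : StrictMono v) :
    lrCoeff (lamOf (oneBased s)) (shapeOf (oneBased r)) (shapeOf v) =
      (T.filter fun Y => (fun i : Fin k => Y k (i.rev : ℕ)) = v).card := by
  refine lrCoeff_eq_card (antitone_lamOf s) (antitone_shapeOf hv) _ fun Y => ?_
  have hcontent : HasContent (fun j => ((r j.rev : ℕ) : ℤ) + 1) 1 Y ↔
      ∀ a : Fin k, content k Y a = shapeOf (oneBased r) a := by
    refine forall_congr' fun a => ?_
    have h : shapeOf (oneBased r) a = ((r a.rev : ℕ) : ℤ) + 1 - ((a.rev : ℕ) : ℤ) := by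
      simp only [shapeOf, oneBased, Fin.val_rev]
      omega
    rw [h]
    rfl
  have hlast : (fun i : Fin k => Y k (i.rev : ℕ)) = v ↔
      ∀ i : Fin k, Y k i = shapeOf v i + ((i.rev : ℕ) : ℤ) := by
    have h : ∀ i : Fin k, shapeOf v i + ((i.rev : ℕ) : ℤ) = v i.rev := by
      intro i
      simp only [shapeOf, Fin.val_rev]
      omega
    simp only [h, funext_iff]
    refine ⟨fun h' i => ?_, fun h' i => ?_⟩
    · rw [← h', Fin.rev_rev]
    · rw [h', Fin.rev_rev]
  rw [mem_filter, hT, hlast, ← hcontent]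
  constructor
  · rintro ⟨h, h'⟩
    exact ⟨⟨(revTuple_lamOf_eq s).symm ▸ h.chain, h'⟩, h.content, h.strip, h.lattice⟩
  · rintro ⟨h, h1, h2, h3⟩
    exact ⟨⟨revTuple_lamOf_eq s ▸ h.chain, h1, h2, h3⟩, h.last⟩

variable {s r} {Y : ℕ → ℕ → ℤ}

theorem IsLRChain.strictMono_last (hY : IsLRChain s r Y) :
    StrictMono fun i : Fin k => Y k (i.rev : ℕ) := by
  have h : StrictAnti fun i : Fin k => Y k (i : ℕ) := by
    cases k with
    | zero => exact fun i => i.elim0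
    | succ n =>
      refine Fin.strictAnti_iff_succ_lt.2 fun i => ?_
      exact hY.chain.lt_of_strip (fun i hi => revTuple_lt s hi) le_rfl hY.strip (by omega)
  exact fun i j hij => h (Fin.rev_lt_rev.2 hij)

theorem IsLRChain.content_eq (hY : IsLRChain s r Y) (j : Fin k) :
    HankelMinor.content k Y j = ((r j.rev : ℕ) : ℤ) + 1 - ((j.rev : ℕ) : ℤ) :=
  hY.content j

theorem IsLRChain.oneBased_le (hY : IsLRChain s r Y) :
    oneBased r ≤ fun i : Fin k => Y k (i.rev : ℕ) := by
  intro i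
  have h := hY.chain.content_add_le_last hY.strip hY.lattice (fun i hi => by
    rw [revTuple, dif_pos hi]
    positivity) i.rev
  rw [hY.content_eq, Fin.rev_rev] at h
  change ((r i : ℕ) : ℤ) + 1 ≤ Y k (i.rev : ℕ)
  omega

/-- The largest entry is at most the largest s, which is at most M - 1, plus the content of letter
0, which is at most N - (k - 1). -/
theorem IsLRChain.last_le (hY : IsLRChain s r Y) (hkM : k ≤ M) (i : Fin k) :
    Y k (i.rev : ℕ) ≤ ((M + N - k : ℕ) : ℤ) := by
  have hk := i.pos
  have h1 := hY.chain.last_zero_le hY.lattice hk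
  have h2 := hY.content_eq ⟨0, hk⟩
  have h3 : Y k (i.rev : ℕ) ≤ Y k ((Fin.rev ⟨0, hk⟩).rev : ℕ) :=
    hY.strictMono_last.monotone (Fin.le_def.2 (by rw [Fin.val_rev]; dsimp only; omega))
  rw [Fin.rev_rev] at h3
  rw [revTuple, dif_pos hk] at h1
  have h4 := (s (Fin.rev ⟨0, hk⟩)).2
  have h5 := (r (Fin.rev ⟨0, hk⟩)).2
  have h6 : ((Fin.rev ⟨0, hk⟩ : Fin k) : ℕ) = k - 1 := by simp [Fin.val_rev]
  dsimp only at h2 h3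
  omega

theorem IsLRChain.last_mem_vStar (hY : IsLRChain s r Y) :
    (fun i : Fin k => Y k (i.rev : ℕ)) ∈ vStar (lamOf (oneBased s)) (oneBased r) := by
  refine mem_vStar_of_le hY.strictMono_last hY.oneBased_le ?_
  have h := hY.chain.sum_last
  simp only [sum_range, hY.content_eq, revTuple_val] at h
  have e1 := Equiv.sum_comp Fin.revPerm fun i : Fin k => Y k (i : ℕ)
  have e2 := Equiv.sum_comp Fin.revPerm fun i : Fin k => ((s i : ℕ) : ℤ)
  have e3 := Equiv.sum_comp Fin.revPerm fun i : Fin k => ((r i : ℕ) : ℤ)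
  simp only [Fin.revPerm_apply, sum_sub_distrib, sum_add_distrib, lamOf, oneBased] at *
  rw [e3, e2] at h
  rw [e1, e2, h]
  ring

theorem IsLRChain.exists_eq_oneBased (hY : IsLRChain s r Y) (hkM : k ≤ M) :
    ∃ q : Fin k ↪o Fin (M + N - k), (fun i : Fin k => Y k (i.rev : ℕ)) = oneBased q := by
  have h1 : ∀ i : Fin k, 1 ≤ Y k (i.rev : ℕ) := fun i => by
    have := hY.oneBased_le i
    simp only [oneBased] at this
    omega
  have h2 := hY.last_le hkM
  refine ⟨OrderEmbedding.ofStrictMono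
    (fun i => ⟨(Y k (i.rev : ℕ) - 1).toNat, by have := h1 i; have := h2 i; omega⟩) ?_, ?_⟩
  · intro i j hij
    have h3 : Y k (i.rev : ℕ) < Y k (j.rev : ℕ) := hY.strictMono_last hij
    have := h1 i
    exact Fin.mk_lt_mk.2 (by omega)
  · funext i
    have := h1 i
    change Y k (i.rev : ℕ) = ((Y k (i.rev : ℕ) - 1).toNat : ℤ) + 1
    omega

theorem bMinor_oneBased (g : ℤ → ℂ) {n : ℕ} (q : Fin k ↪o Fin n) :
    bMinor g (oneBased q) = minor (hankel g 1 k n) (RelEmbedding.refl _) q := by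
  rw [bMinor, minor]
  congr 1
  ext a j
  simp only [hankel, oneBased, Matrix.of_apply, Matrix.submatrix_apply, RelEmbedding.refl_apply]
  congr 1
  ring

variable (s r) in
theorem isLRChain_diagonalChain :
    IsLRChain s r (diagonalChain k (revTuple fun i => ((s i : ℕ) : ℤ))
      (revTuple fun i => ((r i : ℕ) : ℤ) + 1 - ((i : ℕ) : ℤ))) := by
  have h0 : ∀ i < k, 0 ≤ revTuple (fun i => ((r i : ℕ) : ℤ) + 1 - ((i : ℕ) : ℤ)) i := by
    intro i hi
    rw [revTuple, dif_pos hi]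
    have := val_le_of_orderEmbedding r (Fin.rev ⟨i, hi⟩)
    omega
  have he : ∀ i, i + 1 < k → revTuple (fun i => ((r i : ℕ) : ℤ) + 1 - ((i : ℕ) : ℤ)) (i + 1) ≤
      revTuple (fun i => ((r i : ℕ) : ℤ) + 1 - ((i : ℕ) : ℤ)) i := by
    intro i hi
    have h := revTuple_lt r hi
    simp only [revTuple, dif_pos hi, dif_pos (show i < k by omega), Fin.val_rev] at h ⊢
    omega
  refine ⟨isChain_diagonalChain h0, fun j => ?_,
    isStripChain_diagonalChain (fun i hi => revTuple_lt s hi) he,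
    isLatticeChain_diagonalChain h0 he⟩
  rw [content_diagonalChain j.2, revTuple_val]
  rfl

variable (s r) in
/-- The expansion of a minor of a Hankel matrix with Littlewood–Richardson coefficients. -/
theorem minor_hankel_expansion (g : ℤ → ℂ) :
    minor (hankel g 1 M N) s r =
      ∑ v ∈ vStar (lamOf (oneBased s)) (oneBased r),
        (lrCoeff (lamOf (oneBased s)) (shapeOf (oneBased r)) (shapeOf v) : ℂ) * bMinor g v := by
  obtain ⟨T, hT, h⟩ := exists_lrChains g s r
  have hT' : ∀ Y, Y ∈ T ↔ IsLRChain s r Y := fun Y => (hT Y).trans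
    ⟨fun h => ⟨h.1.1, h.1.2, h.2.1, h.2.2⟩, fun h => ⟨⟨h.1, h.2⟩, h.3, h.4⟩⟩
  rw [h, ← sum_fiberwise_of_maps_to fun Y hY => ((hT' Y).1 hY).last_mem_vStar]
  refine sum_congr rfl fun v hv => ?_
  rw [vStar, Set.Finite.mem_toFinset] at hv
  rw [lrCoeff_eq_card_filter s r T hT' hv.1, ← nsmul_eq_mul, ← sum_const]
  refine sum_congr rfl fun Y hY => ?_
  rw [(mem_filter.1 hY).2]

variable (s r) in
theorem lrCoeff_ne_zero_iff {v : Fin k → ℤ}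
    (hv : v ∈ vStar (lamOf (oneBased s)) (oneBased r)) :
    lrCoeff (lamOf (oneBased s)) (shapeOf (oneBased r)) (shapeOf v) ≠ 0 ↔
      ∃ Y, IsLRChain s r Y ∧ (fun i : Fin k => Y k (i.rev : ℕ)) = v := by
  -- Only the finite set of chains is needed; it does not depend on `g`, so 0 will do.
  obtain ⟨T, hT, -⟩ := exists_lrChains 0 s r
  have hT' : ∀ Y, Y ∈ T ↔ IsLRChain s r Y := fun Y => (hT Y).trans
    ⟨fun h => ⟨h.1.1, h.1.2, h.2.1, h.2.2⟩, fun h => ⟨⟨h.1, h.2⟩, h.3, h.4⟩⟩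
  rw [vStar, Set.Finite.mem_toFinset] at hv
  rw [lrCoeff_eq_card_filter s r T hT' hv.1, Finset.card_ne_zero]
  simp only [Finset.Nonempty, mem_filter, hT']

variable (s r) in
theorem exists_eq_oneBased_of_lrCoeff_ne_zero (g : ℤ → ℂ) (hkM : k ≤ M) {v : Fin k → ℤ}
    (hv : v ∈ vStar (lamOf (oneBased s)) (oneBased r))
    (hc : lrCoeff (lamOf (oneBased s)) (shapeOf (oneBased r)) (shapeOf v) ≠ 0) :
    ∃ q : Fin k ↪o Fin (M + N - k), v = oneBased q ∧
      bMinor g v = minor (hankel g 1 k (M + N - k)) (RelEmbedding.refl _) q := by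
  obtain ⟨Y, hY, rfl⟩ := (lrCoeff_ne_zero_iff s r hv).1 hc
  obtain ⟨q, hq⟩ := hY.exists_eq_oneBased hkM
  exact ⟨q, hq, by rw [hq, bMinor_oneBased]⟩

-- The diagonal chain ends in the shape λ + ε. This nonzero coefficient makes the expansion strict.
variable (s r) in
theorem exists_lrCoeff_ne_zero : ∃ v ∈ vStar (lamOf (oneBased s)) (oneBased r),
    lrCoeff (lamOf (oneBased s)) (shapeOf (oneBased r)) (shapeOf v) ≠ 0 := by
  have h := isLRChain_diagonalChain s r
  exact ⟨_, h.last_mem_vStar, (lrCoeff_ne_zero_iff s r h.last_mem_vStar).2 ⟨_, h, rfl⟩⟩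

end Main

/-! ### Transfer of sign consistency. -/

open scoped ComplexOrder in
theorem sum_natCast_mul_nonneg {ι : Type*} {S : Finset ι} {c : ι → ℕ} {b : ι → ℂ}
    (h : ∀ v ∈ S, c v ≠ 0 → 0 ≤ b v) : 0 ≤ ∑ v ∈ S, (c v : ℂ) * b v := by
  refine sum_nonneg fun v hv => ?_
  by_cases hc : c v = 0
  · simp [hc]
  · exact mul_nonneg (Nat.cast_nonneg _) (h v hv hc)

open scoped ComplexOrder in
theorem sum_natCast_mul_pos {ι : Type*} {S : Finset ι} {c : ι → ℕ} {b : ι → ℂ}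
    (h : ∀ v ∈ S, c v ≠ 0 → 0 < b v) (hex : ∃ v ∈ S, c v ≠ 0) :
    0 < ∑ v ∈ S, (c v : ℂ) * b v := by
  obtain ⟨v, hv, hc⟩ := hex
  refine sum_pos' (fun v hv => ?_)
    ⟨v, hv, mul_pos (Nat.cast_pos.2 (Nat.pos_of_ne_zero hc)) (h v hv hc)⟩
  by_cases hc : c v = 0
  · simp [hc]
  · exact mul_nonneg (Nat.cast_nonneg _) (h v hv hc).le

theorem minor_hankel_neg (g : ℤ → ℂ) {M N k : ℕ} (s : Fin k ↪o Fin M) (r : Fin k ↪o Fin N) :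
    -minor (hankel g 1 M N) s r =
      ∑ v ∈ vStar (lamOf (oneBased s)) (oneBased r),
        (lrCoeff (lamOf (oneBased s)) (shapeOf (oneBased r)) (shapeOf v) : ℂ) * -bMinor g v := by
  rw [minor_hankel_expansion]
  simp

open scoped ComplexOrder in
theorem SignConsistent.of_reshaped {g : ℤ → ℂ} {M N k : ℕ} (hkM : k ≤ M)
    (h : SignConsistent k (hankel g 1 k (M + N - k))) : SignConsistent k (hankel g 1 M N) := by
  refine h.imp (fun h s r => ?_) fun h s r => ?_
  · rw [minor_hankel_expansion]
    refine sum_natCast_mul_nonneg fun v hv hc => ?_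
    obtain ⟨q, -, hq⟩ := exists_eq_oneBased_of_lrCoeff_ne_zero s r g hkM hv hc
    exact hq ▸ h _ q
  · rw [← neg_nonneg, minor_hankel_neg]
    refine sum_natCast_mul_nonneg fun v hv hc => ?_
    obtain ⟨q, -, hq⟩ := exists_eq_oneBased_of_lrCoeff_ne_zero s r g hkM hv hc
    exact neg_nonneg.2 (hq ▸ h _ q)

open scoped ComplexOrder in
theorem StrictSignConsistent.of_reshaped {g : ℤ → ℂ} {M N k : ℕ} (hkM : k ≤ M)
    (h : StrictSignConsistent k (hankel g 1 k (M + N - k))) :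
    StrictSignConsistent k (hankel g 1 M N) := by
  refine h.imp (fun h s r => ?_) fun h s r => ?_
  · rw [minor_hankel_expansion]
    refine sum_natCast_mul_pos (fun v hv hc => ?_) (exists_lrCoeff_ne_zero s r)
    obtain ⟨q, -, hq⟩ := exists_eq_oneBased_of_lrCoeff_ne_zero s r g hkM hv hc
    exact hq ▸ h _ q
  · rw [← neg_pos, minor_hankel_neg]
    refine sum_natCast_mul_pos (fun v hv hc => ?_) (exists_lrCoeff_ne_zero s r)
    obtain ⟨q, -, hq⟩ := exists_eq_oneBased_of_lrCoeff_ne_zero s r g hkM hv hc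
    exact neg_pos.2 (hq ▸ h _ q)

end HankelMinor

theorem mainTheorem1 (g : ℤ → ℂ) (M N k : ℕ) (hk : 1 ≤ k) (hkM : k ≤ M) (hkN : k ≤ N) :
    (∀ (s : Fin k ↪o Fin M) (r : Fin k ↪o Fin N),
      HankelMinor.minor (HankelMinor.hankel g 1 M N) s r =
          ∑ v ∈ HankelMinor.vStar (HankelMinor.lamOf (HankelMinor.oneBased s))
              (HankelMinor.oneBased r),
            (HankelMinor.lrCoeff (HankelMinor.lamOf (HankelMinor.oneBased s))
              (HankelMinor.shapeOf (HankelMinor.oneBased r)) (HankelMinor.shapeOf v) : ℂ) *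
              HankelMinor.bMinor g v ∧
        ∀ v ∈ HankelMinor.vStar (HankelMinor.lamOf (HankelMinor.oneBased s))
            (HankelMinor.oneBased r),
          HankelMinor.lrCoeff (HankelMinor.lamOf (HankelMinor.oneBased s))
              (HankelMinor.shapeOf (HankelMinor.oneBased r)) (HankelMinor.shapeOf v) ≠ 0 →
            ∃ q : Fin k ↪o Fin (M + N - k), v = HankelMinor.oneBased q ∧
              HankelMinor.bMinor g v =
                HankelMinor.minor (HankelMinor.hankel g 1 k (M + N - k)) (RelEmbedding.refl _) q) ∧
    (HankelMinor.SignConsistent k (HankelMinor.hankel g 1 k (M + N - k)) →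
      HankelMinor.SignConsistent k (HankelMinor.hankel g 1 M N)) ∧
    (HankelMinor.StrictSignConsistent k (HankelMinor.hankel g 1 k (M + N - k)) →
      HankelMinor.StrictSignConsistent k (HankelMinor.hankel g 1 M N)) :=
  ⟨fun s r => ⟨HankelMinor.minor_hankel_expansion s r g, fun _ hv hc =>
      HankelMinor.exists_eq_oneBased_of_lrCoeff_ne_zero s r g hkM hv hc⟩,
    HankelMinor.SignConsistent.of_reshaped hkM, HankelMinor.StrictSignConsistent.of_reshaped hkM⟩
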